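/- **Setting.** Let $K=2$ and $N\ge 2$. A library $F=(F_1,\dots,F_N)$ consists of $N$ files of $B$ bits each; all $NB$ bits are i.i.d. uniform. The demand vector $\mathbf D=(D_1,D_2)\in[N]^2$ has a fixed distribution giving positive probability to every pair in $[N]^2$. A *scheme with uncoded cache placement* for file size $B$ (all alphabets finite) consists of the following. The cache metadata $(\mathscr M(C_1),\mathscr M(C_2))$ is random with some joint law, with $F$, $\mathbf D$ and the cache metadata independent; $\mathscr M(C_k)$ determines which bits of the library user $k$ copies into its cache; $C_k$ denotes these bits and $Z_k=(\mathscr M(C_k),C_k)$. A trusted server without access to the library chooses the packet metadata $(\mathscr M(P_1),\mathscr M(P_2))$, possibly at random, from $\mathbf D$ and the cache metadata (so that it is conditionally independent of $F$ given these). The metadata $\mathscr M(P_k)$ describes how the packet $P_k$ of user $k$ is composed, i.e. $P_k$ is a function of $\mathscr M(P_k)$ and $F$; user $k$ broadcasts $X_k=(\mathscr M(P_k),P_k)$. With $\mathbf X=(X_1,X_2)$ and entropies in bits, the scheme *works* for cache size $M$, load $R$ and slack $\epsilon\ge 0$ if for $k=1,2$ $$H(Z_k)\le B(M+\epsilon),\qquad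 H(X_k\mid \mathscr M(P_k),Z_k)=0,\qquad H(F_{D_k}\mid \mathbf X,Z_k,D_k)\le B\epsilon,\qquad I(\mathbf D;\mathbf X,Z_k\mid D_k)=0,$$ and $H(X_1)+H(X_2)\le B(R+\epsilon)$. The load $R$ is *achievable* for cache size $M$ if there are $\epsilon_B\ge 0$ with $\epsilon_B\to 0$ as $B\to\infty$ such that for all sufficiently large $B$ some scheme works for $M$, $R$, $\epsilon_B$. Let $R^\star_{\mathrm u}(M)$ be the infimum of the achievable loads. **Theorem.** Let $M=\frac N2+y$ with $y\in[0,\frac N2]$. Then $$R^\star_{\mathrm u}(M)\ \ge\ N-2y-\frac{4y+(N-1)h}{h+2}+\frac{h^2(N-1)-N(N-3)+h(N+1)}{(h+1)(h+2)}\cdot\frac{2y}{N}$$ for every integer $h$ with $0\le h\le N-3$ (no condition if $N=2$), $$R^\star_{\mathrm u}(M)\ \ge\ 2\Bigl(1-\frac{3y}{N}\Bigr),\qquad\text{and}\qquad R^\star_{\mathrm u}(M)\ \ge\ 2\Bigl(\frac12-\frac yN\Bigr).$$ -/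

import Mathlib

open Filter Topology

noncomputable section

namespace D2DCaching

/-! ### Shannon information measures of finitely-valued random variables, in bits -/

section Information

variable {Ω α β γ : Type} [Fintype α] [Fintype β] [Fintype γ]

/-- Shannon entropy `H(X)` (base 2) of the random variable `X` on the probability space `(Ω, P)`. -/
def entropy (P : PMF Ω) (X : Ω → α) : ℝ :=
  (∑ a, Real.negMulLog ((P.map X) a).toReal) / Real.log 2

/-- Conditional entropy `H(X | Y) = H(X, Y) - H(Y)`. -/
def condEntropy (P : PMF Ω) (X : Ω → α) (Y : Ω → β) : ℝ :=
  entropy P (fun ω => (X ω, Y ω)) - entropy P Y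

/-- Conditional mutual information `I(X; Y | Z) = H(X | Z) + H(Y | Z) - H(X, Y | Z)`. -/
def condMutualInfo (P : PMF Ω) (X : Ω → α) (Y : Ω → β) (Z : Ω → γ) : ℝ :=
  condEntropy P X Z + condEntropy P Y Z - condEntropy P (fun ω => (X ω, Y ω)) Z

end Information

/-! ### The `(K, N)` device-to-device caching system with a trusted server -/

/-- A library of `N` files of `B` bits each. -/
abbrev Library (N B : ℕ) : Type := Fin N → Fin B → Bool

/-- A scheme with uncoded cache placement for `K` users, `N` files and `B` bits per file.
All alphabets are finite. -/
structure Scheme (K N B : ℕ) where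
  /-- The possible values of the metadata of the cached content of each user. -/
  CacheMeta : Fin K → Type
  /-- The possible values of the metadata of the packets sent by each user. -/
  PacketMeta : Fin K → Type
  /-- The possible values of the packets sent by each user. -/
  Packet : Fin K → Type
  [fintypeCacheMeta : ∀ k, Fintype (CacheMeta k)]
  [fintypePacketMeta : ∀ k, Fintype (PacketMeta k)]
  [fintypePacket : ∀ k, Fintype (Packet k)]
  /-- The joint law of the cache metadata of all users. It depends neither on the demands nor on
  the content of the library. -/
  placement : PMF ((k : Fin K) → CacheMeta k)
  /-- Uncoded placement: the cache metadata of a user says which bits of the library (bit `b` of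
  file `n` is the pair `(n, b)`) the user copies into its cache. -/
  stored : (k : Fin K) → CacheMeta k → Finset (Fin N × Fin B)
  /-- The trusted server picks the packet metadata of all users, possibly at random, knowing the
  demands and the cache metadata of all users, but not the library. -/
  server : (Fin K → Fin N) → ((k : Fin K) → CacheMeta k) → PMF ((k : Fin K) → PacketMeta k)
  /-- The packet metadata describes how the packet is composed from the bits of the library. -/
  compose : (k : Fin K) → PacketMeta k → Library N B → Packet k

namespace Scheme

attribute [instance] Scheme.fintypeCacheMeta Scheme.fintypePacketMeta Scheme.fintypePacket

variable {K N B : ℕ} (S : Scheme K N B)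

/-- An outcome: demands, cache metadata, packet metadata, library. -/
abbrev Outcome : Type :=
  (Fin K → Fin N) × ((k : Fin K) → S.CacheMeta k) × ((k : Fin K) → S.PacketMeta k) × Library N B

/-- The joint law: the demands, the cache metadata and the library are independent, the bits of the
library are independent and uniform, and the server acts on demands and cache metadata only. -/
def law (demandLaw : PMF (Fin K → Fin N)) : PMF S.Outcome :=
  demandLaw.bind fun d =>
    S.placement.bind fun c =>
      (S.server d c).bind fun p =>
        (PMF.uniformOfFintype (Library N B)).bind fun F =>
          PMF.pure (d, c, p, F)

/-- The demand vector `D`. -/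
def demands (ω : S.Outcome) : Fin K → Fin N := ω.1

/-- The metadata `M(C_k)` of the cached content of user `k`. -/
def cacheMeta (k : Fin K) (ω : S.Outcome) : S.CacheMeta k := ω.2.1 k

/-- The metadata `M(P_k)` of the packets of user `k`. -/
def packetMeta (k : Fin K) (ω : S.Outcome) : S.PacketMeta k := ω.2.2.1 k

/-- The library `(F_1, …, F_N)`. -/
def library (ω : S.Outcome) : Library N B := ω.2.2.2

/-- The cached content `C_k`: the stored bits at their positions, blank elsewhere. -/
def cacheContent (k : Fin K) (ω : S.Outcome) : Fin N → Fin B → Option Bool := fun n b =>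
  if (n, b) ∈ S.stored k (S.cacheMeta k ω) then some (S.library ω n b) else none

/-- The cache `Z_k = (M(C_k), C_k)`. -/
def cache (k : Fin K) (ω : S.Outcome) : S.CacheMeta k × (Fin N → Fin B → Option Bool) :=
  (S.cacheMeta k ω, S.cacheContent k ω)

/-- The transmission `X_k = (M(P_k), P_k)`. -/
def signal (k : Fin K) (ω : S.Outcome) : S.PacketMeta k × S.Packet k :=
  (S.packetMeta k ω, S.compose k (S.packetMeta k ω) (S.library ω))

/-- All transmissions `X = (X_1, …, X_K)`. -/
def signals (ω : S.Outcome) : (k : Fin K) → S.PacketMeta k × S.Packet k :=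
  fun k => S.signal k ω

/-- The file `F_{D_k}` demanded by user `k`. -/
def demandedFile (k : Fin K) (ω : S.Outcome) : Fin B → Bool :=
  S.library ω (S.demands ω k)

/-- The scheme is a private caching scheme with cache size `M`, load `R` and slack `ε`, for demands
distributed according to `demandLaw`. -/
structure Works (demandLaw : PMF (Fin K → Fin N)) (M R ε : ℝ) : Prop where
  cache_size : ∀ k, entropy (S.law demandLaw) (S.cache k) ≤ B * (M + ε)
  encoding : ∀ k, condEntropy (S.law demandLaw) (S.signal k)
    (fun ω => (S.packetMeta k ω, S.cache k ω)) = 0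
  decoding : ∀ k, condEntropy (S.law demandLaw) (S.demandedFile k)
    (fun ω => (S.signals ω, S.cache k ω, S.demands ω k)) ≤ B * ε
  privacy : ∀ k, condMutualInfo (S.law demandLaw) S.demands
    (fun ω => (S.signals ω, S.cache k ω)) (fun ω => S.demands ω k) = 0
  load : ∑ k, entropy (S.law demandLaw) (S.signal k) ≤ B * (R + ε)

end Scheme

/-- The load `R` is achievable for cache size `M` under uncoded cache placement: for all large file
sizes `B` there is a working scheme, with slack `ε_B` tending to `0` as `B → ∞`. -/
def Achievable {K N : ℕ} (demandLaw : PMF (Fin K → Fin N)) (M R : ℝ) : Prop :=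
  ∃ ε : ℕ → ℝ, (∀ B, 0 ≤ ε B) ∧ Tendsto ε atTop (𝓝 0) ∧
    ∀ᶠ B : ℕ in atTop, ∃ S : Scheme K N B, S.Works demandLaw M R (ε B)

/-- The optimal load under uncoded cache placement: the infimum of the achievable loads
(`⊤` if there were none). -/
def optimalLoad {K N : ℕ} (demandLaw : PMF (Fin K → Fin N)) (M : ℝ) : EReal :=
  ⨅ (R : ℝ) (_ : Achievable demandLaw M R), (R : EReal)

end D2DCaching

end

/-! Privacy is what costs load. A user's view reveals nothing about the other demand and every
demand pair has positive probability, so the packet metadata have the same law under all demand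
vectors: change one demand at a time, as seen by the user whose demand stays fixed
(`Scheme.Works.sum_metaProb_congr`).

Fix a value of the packet metadata. If it has positive probability, then for every file `l` some
pair of caches is consistent with it when both users demand `l`. Hence one packet, with the help of
`N` different caches, lets each of the `N` files be recovered up to a small error. Reveal the files
in random order, each after its cache. A bit of file `n` outside the `n`-th cache is counted when
`n` precedes all `t` files whose caches contain that bit, an event of probability `1/(t+1)`
(`sum_revealWeight_le`).

Replace `1/(t+1)` by a line `A - C t` below it; the total of the `t` then counts overlaps of caches
for different demands. A packet is composed of bits cached by its sender, so the sender's cache for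
demand `l` and the receiver's cache for demand `n` almost cover file `n`. This bounds those
overlaps, summed over the two users, by the overlap of the two caches for the single demand `l`
(`card_pair_le`). What remains is a sum over `l` of scores that see only the caches chosen for `l`
(`sum_cacheScore_le`), so selections can be replaced by averages (`sum_weighted_le_mul`).

The placement does not depend on the demands. The mean cache sizes are at most about `B M`, and the
two caches nearly cover the library, so their mean overlap is at most about `B (2M - N)`. The
outcome is the bound `2A(N - M) - C(N - 1)(2M - N)` on the load; the three claims are choices of the
line. -/

namespace D2DCaching

/-! ### Shannon inequalities, with the equality case of Gibbs' inequality -/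

section Entropy

variable {Ω α β γ : Type}

/-- The probability that the random variable `X` takes the value `a`. -/
noncomputable def prob (P : PMF Ω) (X : Ω → α) (a : α) : ℝ := ((P.map X) a).toReal

lemma prob_nonneg (P : PMF Ω) (X : Ω → α) (a : α) : 0 ≤ prob P X a := ENNReal.toReal_nonneg

lemma toReal_map_apply [Fintype Ω] [DecidableEq α] (P : PMF Ω) (X : Ω → α) (a : α) :
    ((P.map X) a).toReal = ∑ ω, if X ω = a then (P ω).toReal else 0 := by
  rw [PMF.map_apply, tsum_fintype, ENNReal.toReal_sum]
  · refine Finset.sum_congr rfl fun ω _ => ?_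
    by_cases h : X ω = a
    · simp [h]
    · rw [if_neg h, if_neg (Ne.symm h), ENNReal.toReal_zero]
  · intro ω _
    split_ifs
    · exact P.apply_ne_top ω
    · exact ENNReal.zero_ne_top

lemma prob_eq_sum [Fintype Ω] [DecidableEq α] (P : PMF Ω) (X : Ω → α) (a : α) :
    prob P X a = ∑ ω, if X ω = a then (P ω).toReal else 0 := toReal_map_apply P X a

lemma prob_comp [Fintype β] [DecidableEq α] (P : PMF Ω) (Y : Ω → β) (g : β → α) (a : α) :
    prob P (fun ω => g (Y ω)) a = ∑ b, if g b = a then prob P Y b else 0 := by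
  have h : P.map (fun ω => g (Y ω)) = (P.map Y).map g := (PMF.map_comp Y P g).symm
  rw [prob, h, toReal_map_apply]
  rfl

lemma sum_prob [Fintype α] (P : PMF Ω) (X : Ω → α) : ∑ a, prob P X a = 1 := by
  have h := (P.map X).tsum_coe
  rw [tsum_fintype] at h
  have h2 := congrArg ENNReal.toReal h
  rw [ENNReal.toReal_sum fun a _ => (P.map X).apply_ne_top a] at h2
  exact h2.trans ENNReal.toReal_one

lemma sum_prob_comp_mul [Fintype α] [Fintype β] (P : PMF Ω) (Y : Ω → β) (g : β → α) (φ : α → ℝ) :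
    ∑ a, prob P (fun ω => g (Y ω)) a * φ a = ∑ b, prob P Y b * φ (g b) := by
  classical
  simp_rw [prob_comp, Finset.sum_mul]
  rw [Finset.sum_comm]
  refine Finset.sum_congr rfl fun b _ => ?_
  simp [ite_mul]

lemma prob_le_prob_comp [Fintype β] (P : PMF Ω) (Y : Ω → β) (g : β → α) (b : β) :
    prob P Y b ≤ prob P (fun ω => g (Y ω)) (g b) := by
  classical
  rw [prob_comp P Y g]
  have h := Finset.single_le_sum (f := fun b' => if g b' = g b then prob P Y b' else 0)
    (fun b' _ => by split_ifs; exacts [prob_nonneg P Y b', le_rfl]) (Finset.mem_univ b)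
  simpa using h

lemma prob_le_one [Fintype α] (P : PMF Ω) (X : Ω → α) (a : α) : prob P X a ≤ 1 := by
  rw [← sum_prob P X]
  exact Finset.single_le_sum (fun b _ => prob_nonneg P X b) (Finset.mem_univ a)

lemma entropy_comp [Fintype α] [Fintype β] (P : PMF Ω) (Y : Ω → β) (g : β → α) :
    entropy P (fun ω => g (Y ω)) * Real.log 2
      = -∑ b, prob P Y b * Real.log (prob P (fun ω => g (Y ω)) (g b)) := by
  have h2 : Real.log 2 ≠ 0 := (Real.log_pos one_lt_two).ne'
  rw [← sum_prob_comp_mul P Y g fun a => Real.log (prob P (fun ω => g (Y ω)) a), entropy,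
    div_mul_cancel₀ _ h2, ← Finset.sum_neg_distrib]
  refine Finset.sum_congr rfl fun a _ => ?_
  rw [Real.negMulLog, prob]
  ring

lemma entropy_mul_log [Fintype α] (P : PMF Ω) (X : Ω → α) :
    entropy P X * Real.log 2 = -∑ a, prob P X a * Real.log (prob P X a) :=
  entropy_comp P X id

lemma entropy_nonneg [Fintype α] (P : PMF Ω) (X : Ω → α) : 0 ≤ entropy P X := by
  refine div_nonneg (Finset.sum_nonneg fun a _ => ?_) (Real.log_pos one_lt_two).le
  exact Real.negMulLog_nonneg (prob_nonneg P X a) (prob_le_one P X a)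

/-- A random variable that is determined by another one has at most its entropy. -/
lemma entropy_le_of_determined [Fintype α] [Fintype β] (P : PMF Ω) {X : Ω → α} {Y : Ω → β}
    (h : ∀ ω ω', Y ω = Y ω' → X ω = X ω') : entropy P X ≤ entropy P Y := by
  obtain ⟨ω₀, -⟩ := P.support_nonempty
  have : Nonempty α := ⟨X ω₀⟩
  obtain ⟨g, rfl⟩ := (Function.factorsThrough_iff (f := Y) X).1 fun ω ω' => h ω ω'
  refine le_of_mul_le_mul_right ?_ (Real.log_pos one_lt_two)
  rw [entropy_mul_log P Y, Function.comp_def, entropy_comp P Y g]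
  refine neg_le_neg (Finset.sum_le_sum fun b _ => ?_)
  rcases (prob_nonneg P Y b).eq_or_lt with h0 | h0
  · simp [← h0]
  · exact mul_le_mul_of_nonneg_left (Real.log_le_log h0 (prob_le_prob_comp P Y g b)) h0.le

lemma entropy_congr [Fintype α] [Fintype β] (P : PMF Ω) {X : Ω → α} {Y : Ω → β}
    (h : ∀ ω ω', Y ω = Y ω' ↔ X ω = X ω') : entropy P X = entropy P Y :=
  le_antisymm (entropy_le_of_determined P fun ω ω' => (h ω ω').1)
    (entropy_le_of_determined P fun ω ω' => (h ω ω').2)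

lemma condEntropy_nonneg [Fintype α] [Fintype β] (P : PMF Ω) (X : Ω → α) (Y : Ω → β) :
    0 ≤ condEntropy P X Y :=
  sub_nonneg.2 (entropy_le_of_determined P fun _ _ h => (Prod.mk.inj h).2)

/-- The summand of Gibbs' inequality. -/
lemma gibbs_term {f g a b : ℝ} (hf : 0 ≤ f) (hfa : f ≤ a) (hfb : f ≤ b) (hag : a ≤ g) :
    f - a * b / g ≤ f * (Real.log f + Real.log g - Real.log a - Real.log b) ∧
    (f - a * b / g = f * (Real.log f + Real.log g - Real.log a - Real.log b) → f * g = a * b) := by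
  rcases hf.eq_or_lt with rfl | hf
  · have : 0 ≤ a * b / g := div_nonneg (mul_nonneg hfa hfb) (hfa.trans hag)
    refine ⟨by simpa using this, fun h => ?_⟩
    have h' : a * b / g = 0 := by simpa using h
    -- `g` may vanish, where the quotient is `0` by convention; then `a ≤ g` forces `a = 0`.
    rcases div_eq_zero_iff.1 h' with h' | h'
    · simp [h']
    · have : a = 0 := le_antisymm (h' ▸ hag) hfa
      simp [this]
  · have ha := hf.trans_le hfa
    have hb := hf.trans_le hfb
    have hg := ha.trans_le hag
    -- Everything reduces to `log r ≤ r - 1`, which is strict unless `r = 1`.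
    set r := a * b / (f * g) with hr
    have hr0 : 0 < r := by positivity
    have h1 : Real.log f + Real.log g - Real.log a - Real.log b = -Real.log r := by
      rw [hr, Real.log_div (by positivity) (by positivity), Real.log_mul ha.ne' hb.ne',
        Real.log_mul hf.ne' hg.ne']
      ring
    have h2 : f - a * b / g = f * (1 - r) := by
      rw [hr]; field_simp
    rw [h1, h2]
    refine ⟨mul_le_mul_of_nonneg_left (by linarith [Real.log_le_sub_one_of_pos hr0]) hf.le,
      fun h => ?_⟩
    have h3 : 1 - r = -Real.log r := mul_left_cancel₀ hf.ne' h
    have h4 : r = 1 := by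
      by_contra hne
      linarith [Real.log_lt_sub_one_of_pos hr0 hne]
    rw [hr, div_eq_one_iff_eq (by positivity)] at h4
    exact h4.symm

/-- All four entropies are written as sums over the joint law, so that Gibbs' inequality can be
applied term by term and its equality case yields conditional independence. -/
lemma condMutualInfo_mul_log [Fintype α] [Fintype β] [Fintype γ] (P : PMF Ω)
    (X : Ω → α) (Y : Ω → β) (Z : Ω → γ) :
    condMutualInfo P X Y Z * Real.log 2 = ∑ t : α × β × γ,
      prob P (fun ω => (X ω, Y ω, Z ω)) t * (Real.log (prob P (fun ω => (X ω, Y ω, Z ω)) t)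
        + Real.log (prob P Z t.2.2) - Real.log (prob P (fun ω => (X ω, Z ω)) (t.1, t.2.2))
        - Real.log (prob P (fun ω => (Y ω, Z ω)) t.2)) := by
  have e1 := entropy_comp P (fun ω => (X ω, Y ω, Z ω)) fun t => (t.1, t.2.2)
  have e2 := entropy_comp P (fun ω => (X ω, Y ω, Z ω)) fun t => t.2
  have e3 := entropy_comp P (fun ω => (X ω, Y ω, Z ω)) fun t => t.2.2
  have e4 := entropy_mul_log P (fun ω => (X ω, Y ω, Z ω))
  have e5 : entropy P (fun ω => ((X ω, Y ω), Z ω)) = entropy P (fun ω => (X ω, Y ω, Z ω)) :=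
    entropy_congr P fun ω ω' => by simp [and_assoc]
  dsimp only at e1 e2 e3
  simp only [condMutualInfo, condEntropy, e5, mul_sub, mul_add, Finset.sum_sub_distrib,
    Finset.sum_add_distrib]
  linear_combination e1 + e2 - e3 - e4

lemma sum_prob_mul_prob_div [Fintype α] [Fintype β] [Fintype γ] (P : PMF Ω)
    (X : Ω → α) (Y : Ω → β) (Z : Ω → γ) :
    ∑ t : α × β × γ, prob P (fun ω => (X ω, Z ω)) (t.1, t.2.2)
      * prob P (fun ω => (Y ω, Z ω)) t.2 / prob P Z t.2.2 = 1 := by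
  classical
  have hX : ∀ c, ∑ a, prob P (fun ω => (X ω, Z ω)) (a, c) = prob P Z c := by
    intro c
    rw [prob_comp P (fun ω => (X ω, Z ω)) Prod.snd c, Fintype.sum_prod_type]
    simp
  have hY : ∀ c, ∑ b, prob P (fun ω => (Y ω, Z ω)) (b, c) = prob P Z c := by
    intro c
    rw [prob_comp P (fun ω => (Y ω, Z ω)) Prod.snd c, Fintype.sum_prod_type]
    simp
  rw [← sum_prob P Z, Fintype.sum_prod_type]
  simp_rw [Fintype.sum_prod_type]
  have : ∀ c, ∑ a, ∑ b, prob P (fun ω => (X ω, Z ω)) (a, c)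
      * prob P (fun ω => (Y ω, Z ω)) (b, c) / prob P Z c = prob P Z c := by
    intro c
    simp_rw [← Finset.sum_div, ← Finset.mul_sum, hY, ← Finset.sum_mul, hX]
    exact mul_self_div_self _
  calc _ = ∑ a, ∑ c, ∑ b, prob P (fun ω => (X ω, Z ω)) (a, c)
      * prob P (fun ω => (Y ω, Z ω)) (b, c) / prob P Z c :=
        Finset.sum_congr rfl fun a _ => Finset.sum_comm
    _ = _ := by
        rw [Finset.sum_comm]
        exact Finset.sum_congr rfl fun c _ => this c

lemma gibbs_prob [Fintype α] [Fintype β] [Fintype γ] (P : PMF Ω)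
    (X : Ω → α) (Y : Ω → β) (Z : Ω → γ) (t : α × β × γ) :
    (prob P (fun ω => (X ω, Y ω, Z ω)) t - prob P (fun ω => (X ω, Z ω)) (t.1, t.2.2)
      * prob P (fun ω => (Y ω, Z ω)) t.2 / prob P Z t.2.2 ≤
    prob P (fun ω => (X ω, Y ω, Z ω)) t * (Real.log (prob P (fun ω => (X ω, Y ω, Z ω)) t)
        + Real.log (prob P Z t.2.2) - Real.log (prob P (fun ω => (X ω, Z ω)) (t.1, t.2.2))
        - Real.log (prob P (fun ω => (Y ω, Z ω)) t.2))) ∧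
    (prob P (fun ω => (X ω, Y ω, Z ω)) t - prob P (fun ω => (X ω, Z ω)) (t.1, t.2.2)
      * prob P (fun ω => (Y ω, Z ω)) t.2 / prob P Z t.2.2 =
    prob P (fun ω => (X ω, Y ω, Z ω)) t * (Real.log (prob P (fun ω => (X ω, Y ω, Z ω)) t)
        + Real.log (prob P Z t.2.2) - Real.log (prob P (fun ω => (X ω, Z ω)) (t.1, t.2.2))
        - Real.log (prob P (fun ω => (Y ω, Z ω)) t.2)) →
      prob P (fun ω => (X ω, Y ω, Z ω)) t * prob P Z t.2.2
        = prob P (fun ω => (X ω, Z ω)) (t.1, t.2.2) * prob P (fun ω => (Y ω, Z ω)) t.2) :=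
  gibbs_term (prob_nonneg _ _ _)
    (prob_le_prob_comp P (fun ω => (X ω, Y ω, Z ω)) (fun t => (t.1, t.2.2)) t)
    (prob_le_prob_comp P (fun ω => (X ω, Y ω, Z ω)) (fun t => t.2) t)
    (prob_le_prob_comp P (fun ω => (X ω, Z ω)) (fun t => t.2) (t.1, t.2.2))

lemma condMutualInfo_nonneg [Fintype α] [Fintype β] [Fintype γ] (P : PMF Ω)
    (X : Ω → α) (Y : Ω → β) (Z : Ω → γ) : 0 ≤ condMutualInfo P X Y Z := by
  refine nonneg_of_mul_nonneg_left ?_ (Real.log_pos one_lt_two)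
  rw [condMutualInfo_mul_log]
  have h := Finset.sum_le_sum fun t (_ : t ∈ Finset.univ) => (gibbs_prob P X Y Z t).1
  rw [Finset.sum_sub_distrib, sum_prob, sum_prob_mul_prob_div, sub_self] at h
  exact h

/-- Vanishing conditional mutual information means conditional independence. -/
lemma prob_mul_prob_of_condMutualInfo_eq_zero [Fintype α] [Fintype β] [Fintype γ] (P : PMF Ω)
    {X : Ω → α} {Y : Ω → β} {Z : Ω → γ} (h : condMutualInfo P X Y Z = 0) (x : α) (y : β) (z : γ) :
    prob P (fun ω => (X ω, Y ω, Z ω)) (x, y, z) * prob P Z z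
      = prob P (fun ω => (X ω, Z ω)) (x, z) * prob P (fun ω => (Y ω, Z ω)) (y, z) := by
  have h0 := condMutualInfo_mul_log P X Y Z
  have h1 : ∑ t : α × β × γ, (prob P (fun ω => (X ω, Y ω, Z ω)) t
      - prob P (fun ω => (X ω, Z ω)) (t.1, t.2.2)
      * prob P (fun ω => (Y ω, Z ω)) t.2 / prob P Z t.2.2) = 0 := by
    rw [Finset.sum_sub_distrib, sum_prob, sum_prob_mul_prob_div, sub_self]
  rw [h, zero_mul, ← h1] at h0
  have h2 := (Finset.sum_eq_sum_iff_of_le fun t _ => (gibbs_prob P X Y Z t).1).1 h0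
  exact (gibbs_prob P X Y Z (x, y, z)).2 (h2 _ (Finset.mem_univ _))

/-- Conditioning on more reduces entropy. -/
lemma condEntropy_prod_le [Fintype α] [Fintype β] [Fintype γ] (P : PMF Ω)
    (X : Ω → α) (Y : Ω → β) (Z : Ω → γ) :
    condEntropy P X (fun ω => (Y ω, Z ω)) ≤ condEntropy P X Z := by
  have h := condMutualInfo_nonneg P X Y Z
  have e : entropy P (fun ω => ((X ω, Y ω), Z ω)) = entropy P (fun ω => (X ω, Y ω, Z ω)) :=
    entropy_congr P fun ω ω' => by simp [and_assoc]
  simp only [condMutualInfo, condEntropy, e] at h ⊢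
  linarith

lemma condEntropy_congr {α' β' : Type} [Fintype α] [Fintype β] [Fintype α'] [Fintype β']
    (P : PMF Ω) {X : Ω → α} {Y : Ω → β} {X' : Ω → α'} {Y' : Ω → β'}
    (hY : ∀ ω ω', Y' ω = Y' ω' ↔ Y ω = Y ω')
    (hX : ∀ ω ω', Y ω = Y ω' → (X' ω = X' ω' ↔ X ω = X ω')) :
    condEntropy P X Y = condEntropy P X' Y' := by
  rw [condEntropy, condEntropy, entropy_congr P hY]
  congr 1
  refine entropy_congr P fun ω ω' => ?_
  simp only [Prod.mk.injEq]
  constructor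
  · rintro ⟨h1, h2⟩
    exact ⟨(hX _ _ ((hY _ _).1 h2)).1 h1, (hY _ _).1 h2⟩
  · rintro ⟨h1, h2⟩
    exact ⟨(hX _ _ h2).2 h1, (hY _ _).2 h2⟩

/-- Conditional entropy decreases when the conditioning variable becomes finer. -/
lemma condEntropy_le_of_determined [Fintype α] [Fintype β] [Fintype γ] (P : PMF Ω)
    (X : Ω → α) {Y : Ω → β} {Z : Ω → γ} (h : ∀ ω ω', Y ω = Y ω' → Z ω = Z ω') :
    condEntropy P X Y ≤ condEntropy P X Z := by
  refine le_trans (le_of_eq ?_) (condEntropy_prod_le P X Y Z)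
  refine condEntropy_congr P (fun ω ω' => ?_) fun ω ω' _ => Iff.rfl
  simp only [Prod.mk.injEq]
  exact ⟨fun h' => h'.1, fun h' => ⟨h', h _ _ h'⟩⟩

lemma condEntropy_prod_eq [Fintype α] [Fintype β] [Fintype γ] (P : PMF Ω)
    (X : Ω → α) (Y : Ω → β) (Z : Ω → γ) :
    condEntropy P (fun ω => (X ω, Y ω)) Z
      = condEntropy P X Z + condEntropy P Y (fun ω => (X ω, Z ω)) := by
  have e : entropy P (fun ω => ((X ω, Y ω), Z ω)) = entropy P (fun ω => (Y ω, X ω, Z ω)) :=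
    entropy_congr P fun ω ω' => by simp only [Prod.mk.injEq]; tauto
  simp only [condEntropy, e]
  ring

lemma condEntropy_le_entropy [Fintype α] [Fintype β] (P : PMF Ω) (X : Ω → α) (Y : Ω → β) :
    condEntropy P X Y ≤ entropy P X := by
  have h := condEntropy_le_of_determined P X (Y := Y) (Z := fun _ => ()) fun _ _ _ => rfl
  refine h.trans ?_
  have h1 := entropy_nonneg P (fun _ : Ω => ())
  have h2 : entropy P (fun ω => (X ω, ())) = entropy P X := entropy_congr P fun ω ω' => by simp
  rw [condEntropy, h2]
  linarith

end Entropy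

/-! ### Entropies of functions of a uniform library -/

section Library

variable {N B : ℕ} {α β : Type} [Fintype α] [Fintype β]

/-- The uniform law of the library. -/
noncomputable abbrev uniformLibrary (N B : ℕ) : PMF (Library N B) :=
  PMF.uniformOfFintype (Library N B)

/-- The bits of the library at the positions in `s`, blank elsewhere. -/
def restr (s : Finset (Fin N × Fin B)) (F : Library N B) : Fin N → Fin B → Option Bool :=
  fun n b => if (n, b) ∈ s then some (F n b) else none

/-- The positions of the bits of file `n`. -/
def file (n : Fin N) : Finset (Fin N × Fin B) := Finset.univ.filter fun b => b.1 = n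

@[simp] lemma mem_file {n : Fin N} {b : Fin N × Fin B} : b ∈ file n ↔ b.1 = n := by simp [file]

lemma restr_eq_iff {s : Finset (Fin N × Fin B)} {F F' : Library N B} :
    restr s F = restr s F' ↔ ∀ b ∈ s, F b.1 b.2 = F' b.1 b.2 := by
  constructor
  · intro h b hb
    have := congrFun (congrFun h b.1) b.2
    simpa [restr, hb] using this
  · intro h
    funext n b
    by_cases hb : (n, b) ∈ s
    · simp [restr, hb, h _ hb]
    · simp [restr, hb]

lemma prob_restr (s : Finset (Fin N × Fin B)) (F₀ : Library N B) :
    prob (uniformLibrary N B) (restr s) (restr s F₀) = (1 / 2 : ℝ) ^ s.card := by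
  classical
  -- The libraries that agree with `F₀` on `s` form a box: one choice at each position in `s`, two
  -- elsewhere.
  have hcard : ((Finset.univ.filter fun F : Library N B => restr s F = restr s F₀).card : ℝ)
      = ∏ b : Fin N × Fin B, if b ∈ s then 1 else 2 := by
    have : (Finset.univ.filter fun F : Library N B => restr s F = restr s F₀)
        = Fintype.piFinset fun n => Fintype.piFinset fun b =>
          if (n, b) ∈ s then {F₀ n b} else Finset.univ := by
      ext F
      simp only [Finset.mem_filter, Finset.mem_univ, true_and, restr_eq_iff,
        Fintype.mem_piFinset]
      constructor
      · intro h n b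
        split_ifs with hb
        · simpa using h _ hb
        · simp
      · intro h b hb
        have := h b.1 b.2
        rw [if_pos hb] at this
        simpa using this
    rw [this, Fintype.card_piFinset, Fintype.prod_prod_type]
    push_cast
    refine Finset.prod_congr rfl fun n _ => ?_
    rw [Fintype.card_piFinset]
    push_cast
    refine Finset.prod_congr rfl fun b _ => ?_
    split_ifs <;> simp
  have htot : (Fintype.card (Library N B) : ℝ) = ∏ _b : Fin N × Fin B, (2 : ℝ) := by
    simp [Library, Fintype.card_pi, pow_mul']
  rw [prob_eq_sum, ← Finset.sum_filter]
  simp only [PMF.uniformOfFintype_apply, Finset.sum_const, nsmul_eq_mul, ENNReal.toReal_inv,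
    ENNReal.toReal_natCast]
  rw [hcard, htot, ← div_eq_mul_inv, ← Finset.prod_div_distrib]
  have : ∀ b : Fin N × Fin B, ((if b ∈ s then 1 else 2 : ℝ) / 2) = if b ∈ s then 1 / 2 else 1 := by
    intro b; split_ifs <;> norm_num
  simp_rw [this]
  rw [← Finset.prod_filter, Finset.prod_const]
  simp

/-- Uniform bits have maximal entropy. -/
lemma entropy_restr (s : Finset (Fin N × Fin B)) :
    entropy (uniformLibrary N B) (restr s) = s.card := by
  have h2 := Real.log_pos one_lt_two
  refine mul_right_cancel₀ h2.ne' ?_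
  have h := entropy_comp (uniformLibrary N B) id (restr s)
  have h1 : ∀ F : Library N B, prob (uniformLibrary N B) (fun ω => restr s (id ω)) (restr s F)
      = (1 / 2 : ℝ) ^ s.card := prob_restr s
  simp_rw [h1, ← Finset.sum_mul, sum_prob] at h
  refine h.trans ?_
  rw [Real.log_pow, one_div, Real.log_inv]
  ring

lemma file_eq_iff {n : Fin N} {F F' : Library N B} :
    F n = F' n ↔ ∀ b ∈ (file n : Finset (Fin N × Fin B)), F b.1 b.2 = F' b.1 b.2 := by
  constructor
  · intro h b hb
    rw [mem_file.1 hb, h]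
  · intro h
    funext b
    exact h (n, b) (by simp)

lemma restr_union_file_eq_iff {n : Fin N} {s : Finset (Fin N × Fin B)} {F F' : Library N B} :
    restr (s ∪ file n) F = restr (s ∪ file n) F' ↔ F n = F' n ∧ restr s F = restr s F' := by
  rw [restr_eq_iff, restr_eq_iff, file_eq_iff]
  simp only [Finset.mem_union]
  constructor
  · exact fun h => ⟨fun b hb => h b (.inr hb), fun b hb => h b (.inl hb)⟩
  · exact fun h b hb => hb.elim (h.2 b) (h.1 b)

lemma restr_mono {s t : Finset (Fin N × Fin B)} (h : s ⊆ t) {F F' : Library N B}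
    (he : restr t F = restr t F') : restr s F = restr s F' :=
  restr_eq_iff.2 fun b hb => restr_eq_iff.1 he b (h hb)

/-- Given some bits, the entropy of a file is the number of its missing bits. -/
lemma condEntropy_file (n : Fin N) (s : Finset (Fin N × Fin B)) :
    condEntropy (uniformLibrary N B) (fun F => F n) (restr s) = (file n \ s).card := by
  have h : entropy (uniformLibrary N B) (fun F => (F n, restr s F))
      = entropy (uniformLibrary N B) (restr (s ∪ file n)) :=
    entropy_congr _ fun F F' => by rw [restr_union_file_eq_iff, Prod.mk.injEq]
  rw [condEntropy, h, entropy_restr, entropy_restr, ← Finset.union_sdiff_self_eq_union,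
    Finset.card_union_of_disjoint Finset.disjoint_sdiff]
  push_cast
  ring

lemma condEntropy_le_add {Ω α β γ : Type} [Fintype α] [Fintype β] [Fintype γ] (P : PMF Ω)
    (X : Ω → α) (Y : Ω → β) (Z : Ω → γ) :
    condEntropy P X Z ≤ condEntropy P Y Z + condEntropy P X (fun ω => (Y ω, Z ω)) := by
  have h := condEntropy_prod_eq P X Y Z
  have h1 := condEntropy_prod_eq P Y X Z
  have h2 := condEntropy_nonneg P Y (fun ω => (X ω, Z ω))
  have h3 : condEntropy P (fun ω => (Y ω, X ω)) Z = condEntropy P (fun ω => (X ω, Y ω)) Z :=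
    condEntropy_congr P (fun ω ω' => Iff.rfl) fun ω ω' _ => by
      simp only [Prod.mk.injEq]; tauto
  linarith

/-- If a packet composed of the bits in `t` lets one decode file `n` from the bits in `s`,
then `s` and `t` almost cover file `n`. -/
lemma card_file_sdiff_union_le (n : Fin N) (s t : Finset (Fin N × Fin B)) (P : Library N B → α)
    (hP : condEntropy (uniformLibrary N B) P (restr t) = 0) :
    ((file n \ (s ∪ t)).card : ℝ)
      ≤ condEntropy (uniformLibrary N B) (fun F => F n) (fun F => (P F, restr s F)) := by
  rw [← condEntropy_file]
  refine (condEntropy_le_add _ _ P _).trans ?_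
  have h1 : condEntropy (uniformLibrary N B) P (restr (s ∪ t)) ≤ 0 := by
    rw [← hP]
    exact condEntropy_le_of_determined _ _ fun F F' => restr_mono Finset.subset_union_right
  have h2 : condEntropy (uniformLibrary N B) (fun F => F n) (fun F => (P F, restr (s ∪ t) F))
      ≤ condEntropy (uniformLibrary N B) (fun F => F n) (fun F => (P F, restr s F)) := by
    refine condEntropy_le_of_determined _ _ fun F F' h => ?_
    rw [Prod.mk.injEq] at h ⊢
    exact ⟨h.1, restr_mono Finset.subset_union_left h.2⟩
  linarith

/-- One step of the revealing argument: after conditioning on the cache `c` as well, expand the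
joint entropy of `P` and file `m` in both orders. The file has as much entropy as it has missing
bits, and the packet with `c` leaves only the decoding error. -/
lemma condEntropy_restr_step (P : Library N B → α) (S c : Finset (Fin N × Fin B)) (m : Fin N) :
    ((file m \ (S ∪ c)).card : ℝ)
      - condEntropy (uniformLibrary N B) (fun F => F m) (fun F => (P F, restr c F))
      + condEntropy (uniformLibrary N B) P (restr (S ∪ c ∪ file m))
      ≤ condEntropy (uniformLibrary N B) P (restr S) := by
  have h1 : condEntropy (uniformLibrary N B) P (restr (S ∪ c))
      ≤ condEntropy (uniformLibrary N B) P (restr S) :=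
    condEntropy_le_of_determined _ _ fun F F' => restr_mono Finset.subset_union_left
  have h2 : condEntropy (uniformLibrary N B) (fun F => F m) (fun F => (P F, restr (S ∪ c) F))
      ≤ condEntropy (uniformLibrary N B) (fun F => F m) (fun F => (P F, restr c F)) := by
    refine condEntropy_le_of_determined _ _ fun F F' h => ?_
    rw [Prod.mk.injEq] at h ⊢
    exact ⟨h.1, restr_mono Finset.subset_union_right h.2⟩
  have h3 := condEntropy_prod_eq (uniformLibrary N B) P (fun F => F m) (restr (S ∪ c))
  have h4 := condEntropy_prod_eq (uniformLibrary N B) (fun F => F m) P (restr (S ∪ c))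
  have h5 : condEntropy (uniformLibrary N B) (fun F => (F m, P F)) (restr (S ∪ c))
      = condEntropy (uniformLibrary N B) (fun F => (P F, F m)) (restr (S ∪ c)) :=
    condEntropy_congr _ (fun F F' => Iff.rfl) fun F F' _ => by
      simp only [Prod.mk.injEq]; tauto
  have h6 : condEntropy (uniformLibrary N B) P (fun F => (F m, restr (S ∪ c) F))
      = condEntropy (uniformLibrary N B) P (restr (S ∪ c ∪ file m)) :=
    condEntropy_congr _ (fun F F' => by rw [restr_union_file_eq_iff, Prod.mk.injEq])
      fun F F' _ => Iff.rfl
  rw [condEntropy_file] at h4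
  linarith

/-! ### Revealing the files in random order -/

open Classical in
/-- The weight of a bit in the bound obtained by revealing the files in `V` in a uniformly random
order, each together with its cache. -/
noncomputable def revealWeight (c : Fin N → Finset (Fin N × Fin B)) (V : Finset (Fin N))
    (S : Finset (Fin N × Fin B)) (b : Fin N × Fin B) : ℝ :=
  if b.1 ∈ V ∧ b ∉ S ∧ b ∉ c b.1 then 1 / (((V.filter fun l => b ∈ c l).card : ℝ) + 1) else 0

lemma revealWeight_nonneg (c : Fin N → Finset (Fin N × Fin B)) (V : Finset (Fin N))
    (S : Finset (Fin N × Fin B)) (b : Fin N × Fin B) : 0 ≤ revealWeight c V S b := by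
  unfold revealWeight
  split_ifs <;> positivity

/-- This is the recursion for the probability that `b.1` precedes all `l ∈ V` with `b ∈ c l`,
conditioned on the first file `m`: the bit is lost if `b ∈ c m`, counted if `m = b.1`, and keeps its
weight otherwise. -/
lemma card_mul_revealWeight_le (c : Fin N → Finset (Fin N × Fin B)) (V : Finset (Fin N))
    (S : Finset (Fin N × Fin B)) (b : Fin N × Fin B) :
    (V.card : ℝ) * revealWeight c V S b ≤ ∑ m ∈ V, ((if b ∈ file m \ (S ∪ c m) then 1 else 0)
      + revealWeight c (V.erase m) (S ∪ c m ∪ file m) b) := by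
  classical
  by_cases hb : b.1 ∈ V ∧ b ∉ S ∧ b ∉ c b.1
  swap
  · rw [revealWeight, if_neg hb, mul_zero]
    refine Finset.sum_nonneg fun m _ => add_nonneg ?_ (revealWeight_nonneg _ _ _ _)
    split_ifs <;> norm_num
  obtain ⟨hV, hS, hc⟩ := hb
  set τ := V.filter fun l => b ∈ c l with hτ
  -- The value `1` gained at `m = b.1` is split as `1/(τ+1) + τ/(τ+1)`; the total is then `(|V| -
  -- τ)/(τ+1) + τ/(τ+1) = |V|/(τ+1)`, where `τ` stands for its cardinality.
  have key : ∀ m ∈ V, ((if b ∈ c m then 0 else 1 / ((τ.card : ℝ) + 1))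
      + (if b.1 = m then (τ.card : ℝ) / (τ.card + 1) else 0)) ≤
      (if b ∈ file m \ (S ∪ c m) then (1 : ℝ) else 0)
      + revealWeight c (V.erase m) (S ∪ c m ∪ file m) b := by
    intro m hm
    by_cases hmc : b ∈ c m
    · have hne : b.1 ≠ m := fun h => hc (h ▸ hmc)
      rw [if_pos hmc, if_neg hne, add_zero]
      refine add_nonneg ?_ (revealWeight_nonneg _ _ _ _)
      split_ifs <;> norm_num
    · rw [if_neg hmc]
      by_cases hne : b.1 = m
      · rw [if_pos hne, if_pos (by simp [hne, hS, hmc]), ← add_div, add_comm (1 : ℝ),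
          div_self (by positivity)]
        linarith [revealWeight_nonneg c (V.erase m) (S ∪ c m ∪ file m) b]
      · have hfil : ((V.erase m).filter fun l => b ∈ c l) = τ := by
          rw [Finset.filter_erase, Finset.erase_eq_of_notMem]
          simp [hmc]
        rw [if_neg hne, if_neg (by simp [hne]), revealWeight,
          if_pos ⟨by simp [hne, hV], by simp [hS, hmc, hne], hc⟩, hfil, add_zero, zero_add]
  refine le_trans (le_of_eq ?_) (Finset.sum_le_sum key)
  rw [Finset.sum_add_distrib, Finset.sum_ite_eq V b.1, if_pos hV, Finset.sum_ite,
    Finset.sum_const_zero, zero_add, Finset.sum_const, revealWeight, if_pos ⟨hV, hS, hc⟩, ← hτ,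
    nsmul_eq_mul]
  have hcard := Finset.card_filter_add_card_filter_not (s := V) fun l => b ∈ c l
  have hcard' : (V.card : ℝ) = τ.card + (V.filter fun l => b ∉ c l).card := by
    rw [← hcard]; push_cast; rfl
  rw [hcard']
  field_simp
  ring

/-- Lower bound on the entropy of a packet from which, for every `n`, file `n` can be decoded with
the help of the bits in `c n`. -/
lemma sum_revealWeight_le (P : Library N B → α) (c : Fin N → Finset (Fin N × Fin B))
    (V : Finset (Fin N)) (S : Finset (Fin N × Fin B)) :
    ∑ b, revealWeight c V S b
      - ∑ n ∈ V, condEntropy (uniformLibrary N B) (fun F => F n) (fun F => (P F, restr (c n) F))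
      ≤ condEntropy (uniformLibrary N B) P (restr S) := by
  classical
  induction hk : V.card generalizing V S with
  | zero =>
    rw [Finset.card_eq_zero] at hk
    subst hk
    simpa [revealWeight] using condEntropy_nonneg (uniformLibrary N B) P (restr S)
  | succ k ih =>
    set δ := fun n =>
      condEntropy (uniformLibrary N B) (fun F => F n) (fun F => (P F, restr (c n) F)) with hδ
    -- Any `m ∈ V` may be revealed first; averaging these bounds over `m` produces the uniformly
    -- random order.
    have hstep : ∀ m ∈ V, ∑ b, ((if b ∈ file m \ (S ∪ c m) then 1 else 0)
        + revealWeight c (V.erase m) (S ∪ c m ∪ file m) b)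
        ≤ condEntropy (uniformLibrary N B) P (restr S) + ∑ n ∈ V, δ n := by
      intro m hm
      have h1 := condEntropy_restr_step P S (c m) m
      have h2 := ih (V.erase m) (S ∪ c m ∪ file m) (by rw [Finset.card_erase_of_mem hm, hk]; rfl)
      have h3 := Finset.add_sum_erase V δ hm
      have h4 : ∑ b : Fin N × Fin B, (if b ∈ file m \ (S ∪ c m) then (1 : ℝ) else 0)
          = (file m \ (S ∪ c m)).card := by
        rw [Finset.sum_ite_mem, Finset.univ_inter]
        simp
      rw [Finset.sum_add_distrib, h4]
      simp only [hδ] at h3 ⊢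
      linarith
    have hsum := Finset.sum_le_sum hstep
    rw [Finset.sum_comm, Finset.sum_const, nsmul_eq_mul] at hsum
    have hpt := Finset.sum_le_sum fun b (_ : b ∈ Finset.univ) => card_mul_revealWeight_le c V S b
    rw [← Finset.mul_sum] at hpt
    have hpos : (0 : ℝ) < V.card := by rw [hk]; positivity
    have := le_of_mul_le_mul_left (hpt.trans hsum) hpos
    linarith

end Library

/-! ### Both packets, for fixed packet metadata -/

section TwoPackets

variable {N B : ℕ}

lemma sum_revealWeight_univ_ge {A C : ℝ} (hAC : ∀ t : ℕ, t < N → A - C * t ≤ 1 / ((t : ℝ) + 1))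
    (c : Fin N → Finset (Fin N × Fin B)) :
    A * ∑ n, ((file n \ c n).card : ℝ) - C * ∑ n, ∑ l, (((file n \ c n) ∩ c l).card : ℝ)
      ≤ ∑ b, revealWeight c Finset.univ ∅ b := by
  classical
  have h : ∀ n : Fin N, A * ((file n \ c n).card : ℝ) - C * ∑ l, (((file n \ c n) ∩ c l).card : ℝ)
      ≤ ∑ b ∈ file n, revealWeight c Finset.univ ∅ b := by
    intro n
    have h1 : ∑ b ∈ file n \ c n, (A - C * ((Finset.univ.filter fun l => b ∈ c l).card : ℝ))
        ≤ ∑ b ∈ file n \ c n, revealWeight c Finset.univ ∅ b := by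
      refine Finset.sum_le_sum fun b hb => ?_
      simp only [Finset.mem_sdiff, mem_file] at hb
      rw [revealWeight, if_pos ⟨Finset.mem_univ _, Finset.notMem_empty _, hb.1 ▸ hb.2⟩]
      refine hAC _ ?_
      -- The cache of the bit's own file does not contain it, so at most `N - 1` caches do and the
      -- line is only needed for `t < N`.
      have : (Finset.univ.filter fun l => b ∈ c l).card < (Finset.univ : Finset (Fin N)).card := by
        refine Finset.card_lt_card (Finset.filter_ssubset.2 ⟨n, Finset.mem_univ _, hb.2⟩)
      simpa using this
    refine le_trans (le_of_eq ?_) (h1.trans (Finset.sum_le_sum_of_subset_of_nonneg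
      Finset.sdiff_subset fun b _ _ => revealWeight_nonneg _ _ _ _))
    rw [Finset.sum_sub_distrib, ← Finset.mul_sum, Finset.sum_const, nsmul_eq_mul, mul_comm A]
    congr 2
    have h2 : ∀ l, (((file n \ c n) ∩ c l).card : ℝ)
        = ∑ b ∈ file n \ c n, if b ∈ c l then 1 else 0 := by
      intro l
      rw [← Finset.filter_mem_eq_inter, Finset.sum_boole]
    simp_rw [h2]
    rw [Finset.sum_comm]
    exact Finset.sum_congr rfl fun b _ => by rw [Finset.sum_boole]
  have h3 := Finset.sum_le_sum fun n (_ : n ∈ Finset.univ) => h n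
  rw [Finset.sum_sub_distrib, ← Finset.mul_sum, ← Finset.mul_sum] at h3
  refine h3.trans (le_of_eq ?_)
  exact Finset.sum_fiberwise _ (fun b : Fin N × Fin B => b.1) _

variable {α : Fin 2 → Type} [∀ k, Fintype (α k)]

/-- What a user cannot infer about file `n` from both packets and the bits in `s`. -/
noncomputable def residual (P : (k : Fin 2) → Library N B → α k) (s : Finset (Fin N × Fin B))
    (n : Fin N) : ℝ :=
  condEntropy (uniformLibrary N B) (fun F => F n) (fun F => ((fun k => P k F), restr s F))

lemma residual_nonneg (P : (k : Fin 2) → Library N B → α k) (s : Finset (Fin N × Fin B))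
    (n : Fin N) : 0 ≤ residual P s n := condEntropy_nonneg _ _ _

/-- A packet composed of cached bits does not help its own sender. -/
lemma condEntropy_le_residual (P : (k : Fin 2) → Library N B → α k) {s : Finset (Fin N × Fin B)}
    (n : Fin N) {j k : Fin 2} (hjk : j ≠ k)
    (h : condEntropy (uniformLibrary N B) (P k) (restr s) = 0) :
    condEntropy (uniformLibrary N B) (fun F => F n) (fun F => (P j F, restr s F))
      ≤ residual P s n := by
  refine (condEntropy_le_add _ _ (P k) _).trans ?_
  have h1 : condEntropy (uniformLibrary N B) (P k) (fun F => (P j F, restr s F)) ≤ 0 := by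
    rw [← h]
    exact condEntropy_prod_le _ _ _ _
  have h2 : condEntropy (uniformLibrary N B) (fun F => F n) (fun F => (P k F, P j F, restr s F))
      ≤ residual P s n := by
    refine condEntropy_le_of_determined _ _ fun F F' he => ?_
    simp only [Prod.mk.injEq] at he ⊢
    refine ⟨funext fun i => ?_, he.2.2⟩
    have hi : i = k ∨ i = j := by omega
    rcases hi with rfl | rfl
    exacts [he.1, he.2.1]
  linarith

/-- Away from the three uncovered sets, a point of `(f \ a) ∩ a'` lies in `b'`, and a point of `(f \
b) ∩ b'` lies in both `a'` and `a`. Both thus lie in `f ∩ a' ∩ b'`, the former outside `a` and the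
latter inside, so nothing is counted twice. In use, `a, b` are the caches for demand `n` and `a',
b'` those for demand `l`. -/
lemma card_pair_le {f a a' b b' : Finset (Fin N × Fin B)} :
    ((f \ a) ∩ a').card + ((f \ b) ∩ b').card
      ≤ (f ∩ a' ∩ b').card + (f \ (b ∪ a')).card + (f \ (b ∪ a)).card + (f \ (a ∪ b')).card := by
  classical
  have h1 : ((f \ b) ∩ b').card ≤ ((f ∩ a' ∩ b') ∩ a).card + (f \ (b ∪ a')).card
      + (f \ (b ∪ a)).card := by
    refine le_trans (Finset.card_le_card (t := ((f ∩ a' ∩ b') ∩ a) ∪ (f \ (b ∪ a')) ∪ (f \ (b ∪ a)))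
      ?_) ((Finset.card_union_le _ _).trans (Nat.add_le_add_right (Finset.card_union_le _ _) _))
    intro x
    simp only [Finset.mem_union, Finset.mem_inter, Finset.mem_sdiff]
    tauto
  have h2 : ((f \ a) ∩ a').card ≤ ((f ∩ a' ∩ b') \ a).card + (f \ (a ∪ b')).card := by
    refine le_trans (Finset.card_le_card (t := ((f ∩ a' ∩ b') \ a) ∪ (f \ (a ∪ b'))) ?_)
      (Finset.card_union_le _ _)
    intro x
    simp only [Finset.mem_union, Finset.mem_inter, Finset.mem_sdiff]
    tauto
  have h3 := Finset.card_inter_add_card_sdiff (f ∩ a' ∩ b') a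
  omega

/-- The contribution of the caches `s k` of the two users, when both demand file `l`. -/
noncomputable def cacheScore (A C : ℝ) (P : (k : Fin 2) → Library N B → α k)
    (s : Fin 2 → Finset (Fin N × Fin B)) (l : Fin N) : ℝ :=
  A * (((file l \ s 0).card : ℝ) + (file l \ s 1).card)
    - C * ∑ n ∈ Finset.univ.erase l, ((file n ∩ s 0 ∩ s 1).card : ℝ)
    - (1 + 3 * C * N) * (residual P (s 0) l + residual P (s 1) l)

/-- For a fixed composition of the packets, each choice of caches consistent with it, one for each
file demanded by both users, bounds the entropy of the packets. -/
lemma sum_cacheScore_le {A C : ℝ} (hC : 0 ≤ C)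
    (hAC : ∀ t : ℕ, t < N → A - C * t ≤ 1 / ((t : ℝ) + 1))
    (P : (k : Fin 2) → Library N B → α k) (c : Fin N → Fin 2 → Finset (Fin N × Fin B))
    (henc : ∀ l k, condEntropy (uniformLibrary N B) (P k) (restr (c l k)) = 0) :
    ∑ l, cacheScore A C P (c l) l
      ≤ entropy (uniformLibrary N B) (P 0) + entropy (uniformLibrary N B) (P 1) := by
  classical
  have hpkt : ∀ j k : Fin 2, j ≠ k → A * ∑ n, ((file n \ c n k).card : ℝ)
      - C * ∑ n, ∑ l, (((file n \ c n k) ∩ c l k).card : ℝ) - ∑ n, residual P (c n k) n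
      ≤ entropy (uniformLibrary N B) (P j) := by
    intro j k hjk
    have h1 := sum_revealWeight_univ_ge hAC fun n => c n k
    have h2 := sum_revealWeight_le (P j) (fun n => c n k) Finset.univ ∅
    have h3 := Finset.sum_le_sum fun n (_ : n ∈ Finset.univ) =>
      condEntropy_le_residual P n hjk (henc n k)
    have h4 := condEntropy_le_entropy (uniformLibrary N B) (P j)
      (restr (∅ : Finset (Fin N × Fin B)))
    linarith
  -- Packet `j` is determined by the cache `c l j` for any `l`, while its receiver decodes file `n`
  -- with `c n k`; hence these two caches, chosen for different demands, almost cover file `n`.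
  have hcover : ∀ j k : Fin 2, j ≠ k → ∀ n l,
      ((file n \ (c n k ∪ c l j)).card : ℝ) ≤ residual P (c n k) n := fun j k hjk n l =>
    (card_file_sdiff_union_le n _ _ (P j) (henc l j)).trans
      (condEntropy_le_residual P n hjk (henc n k))
  -- The factor `3` stands for the three uncovered sets. Summed over `l` it becomes `3 * N`, whence
  -- the term `3 * C * N` in `cacheScore`.
  have hpair : ∀ n l, (((file n \ c n 0) ∩ c l 0).card : ℝ) + ((file n \ c n 1) ∩ c l 1).card
      ≤ (if n = l then 0 else ((file n ∩ c l 0 ∩ c l 1).card : ℝ))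
        + 3 * (residual P (c n 0) n + residual P (c n 1) n) := by
    intro n l
    have r0 := residual_nonneg P (c n 0) n
    have r1 := residual_nonneg P (c n 1) n
    by_cases hnl : n = l
    · subst hnl
      simp only [Finset.sdiff_inter_self, Finset.card_empty, if_true]
      push_cast
      linarith
    · have h := card_pair_le (f := file n) (a := c n 0) (a' := c l 0) (b := c n 1) (b' := c l 1)
      have h1 := hcover 0 1 (by decide) n l
      have h2 := hcover 0 1 (by decide) n n
      have h3 := hcover 1 0 (by decide) n l
      rw [if_neg hnl]
      have h' : (((file n \ c n 0) ∩ c l 0).card : ℝ) + ((file n \ c n 1) ∩ c l 1).card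
        ≤ (file n ∩ c l 0 ∩ c l 1).card + (file n \ (c n 1 ∪ c l 0)).card
          + (file n \ (c n 1 ∪ c n 0)).card + (file n \ (c n 0 ∪ c l 1)).card := by
        exact_mod_cast h
      linarith
  have hsum := Finset.sum_le_sum fun n (_ : n ∈ Finset.univ) =>
    Finset.sum_le_sum fun l (_ : l ∈ Finset.univ) => hpair n l
  simp only [Finset.sum_add_distrib, Finset.sum_const, Finset.card_univ, Fintype.card_fin,
    nsmul_eq_mul, ← Finset.mul_sum] at hsum
  have hdiag : ∑ n : Fin N, ∑ l : Fin N, (if n = l then 0 else ((file n ∩ c l 0 ∩ c l 1).card : ℝ))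
      = ∑ l, ∑ n ∈ Finset.univ.erase l, ((file n ∩ c l 0 ∩ c l 1).card : ℝ) := by
    rw [Finset.sum_comm]
    refine Finset.sum_congr rfl fun l _ => ?_
    rw [← Finset.sum_erase_add _ _ (Finset.mem_univ l), if_pos rfl, add_zero]
    exact Finset.sum_congr rfl fun n hn => if_neg (Finset.ne_of_mem_erase hn)
  rw [hdiag] at hsum
  have hCsum := mul_le_mul_of_nonneg_left hsum hC
  have p0 := hpkt 1 0 (by decide)
  have p1 := hpkt 0 1 (by decide)
  simp only [cacheScore, Finset.sum_sub_distrib, Finset.sum_add_distrib, ← Finset.mul_sum]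
  linarith

end TwoPackets

/-! ### Data processing -/

section Projection

variable {Ω α β β' γ : Type} [Fintype α] [Fintype β] [Fintype β'] [Fintype γ]

lemma condMutualInfo_eq_sub (P : PMF Ω) (X : Ω → α) (Y : Ω → β) (Z : Ω → γ) :
    condMutualInfo P X Y Z = condEntropy P X Z - condEntropy P X (fun ω => (Y ω, Z ω)) := by
  have h := condEntropy_prod_eq P Y X Z
  have h3 : condEntropy P (fun ω => (Y ω, X ω)) Z = condEntropy P (fun ω => (X ω, Y ω)) Z :=
    condEntropy_congr P (fun ω ω' => Iff.rfl) fun ω ω' _ => by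
      simp only [Prod.mk.injEq]; tauto
  rw [condMutualInfo]
  linarith

/-- The data processing inequality, for vanishing conditional mutual information. -/
lemma condMutualInfo_eq_zero_of_determined (P : PMF Ω) {X : Ω → α} {Y : Ω → β} {Y' : Ω → β'}
    {Z : Ω → γ} (h : condMutualInfo P X Y Z = 0) (hY : ∀ ω ω', Y ω = Y ω' → Y' ω = Y' ω') :
    condMutualInfo P X Y' Z = 0 := by
  refine le_antisymm ?_ (condMutualInfo_nonneg P X Y' Z)
  rw [← h, condMutualInfo_eq_sub, condMutualInfo_eq_sub]
  refine sub_le_sub_left (condEntropy_le_of_determined P X fun ω ω' he => ?_) _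
  rw [Prod.mk.injEq] at he ⊢
  exact ⟨hY _ _ he.1, he.2⟩

end Projection

/-! ### Separating metadata from the library, and the effect of privacy -/

namespace Scheme

variable {K N B : ℕ} (S : Scheme K N B) (demandLaw : PMF (Fin K → Fin N))

/-- The demands and all metadata. -/
abbrev MetaOutcome : Type :=
  (Fin K → Fin N) × ((k : Fin K) → S.CacheMeta k) × ((k : Fin K) → S.PacketMeta k)

/-- The joint law of the demands and all metadata. -/
noncomputable def metaLaw : PMF S.MetaOutcome :=
  demandLaw.bind fun d => S.placement.bind fun c => (S.server d c).map fun p => (d, c, p)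

/-- The demands and all metadata of an outcome. -/
def metaOf (ω : S.Outcome) : S.MetaOutcome := (ω.1, ω.2.1, ω.2.2.1)

/-- The probability of the given metadata when the demands are given. -/
noncomputable def metaProb (d : Fin K → Fin N) (c : (k : Fin K) → S.CacheMeta k)
    (p : (k : Fin K) → S.PacketMeta k) : ℝ :=
  (S.placement c).toReal * (S.server d c p).toReal

lemma metaProb_nonneg (d : Fin K → Fin N) (c : (k : Fin K) → S.CacheMeta k)
    (p : (k : Fin K) → S.PacketMeta k) : 0 ≤ S.metaProb d c p :=
  mul_nonneg ENNReal.toReal_nonneg ENNReal.toReal_nonneg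

lemma sum_toReal {α : Type} [Fintype α] (q : PMF α) : ∑ a, (q a).toReal = 1 := by
  have h := sum_prob q id
  simpa only [prob, PMF.map_id] using h

lemma sum_metaProb (d : Fin K → Fin N) (c : (k : Fin K) → S.CacheMeta k) :
    ∑ p, S.metaProb d c p = (S.placement c).toReal := by
  simp only [metaProb, ← Finset.mul_sum, sum_toReal, mul_one]

lemma metaLaw_apply (d : Fin K → Fin N) (c : (k : Fin K) → S.CacheMeta k)
    (p : (k : Fin K) → S.PacketMeta k) :
    prob (S.metaLaw demandLaw) id (d, c, p) = (demandLaw d).toReal * S.metaProb d c p := by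
  classical
  have h : S.metaLaw demandLaw (d, c, p) = demandLaw d * (S.placement c * S.server d c p) := by
    rw [metaLaw, PMF.bind_apply, tsum_eq_single d, PMF.bind_apply, tsum_eq_single c,
      PMF.map_apply, tsum_eq_single p]
    · simp
    · intro p' hp'
      simp [hp'.symm]
    · intro c' hc'
      rw [PMF.map_apply]
      simp [hc'.symm]
    · intro d' hd'
      simp [PMF.bind_apply, PMF.map_apply, hd'.symm]
  rw [prob, PMF.map_id, h, ENNReal.toReal_mul, ENNReal.toReal_mul, metaProb]

/-- The server does not see the library, so given any part of the metadata the library is still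
uniform. -/
lemma law_map {μ β : Type} (m : S.MetaOutcome → μ) (g : μ → Library N B → β) :
    (S.law demandLaw).map (fun ω => (m (S.metaOf ω), g (m (S.metaOf ω)) (S.library ω)))
      = ((S.metaLaw demandLaw).map m).bind fun a =>
        ((uniformLibrary N B).map (g a)).map (Prod.mk a) := by
  simp only [law, metaLaw, PMF.map_bind, PMF.bind_bind, PMF.bind_map, PMF.map_comp, PMF.pure_map]
  rfl

lemma prob_law_mixed {μ β : Type} (m : S.MetaOutcome → μ) (g : μ → Library N B → β)
    (a : μ) (b : β) :
    prob (S.law demandLaw) (fun ω => (m (S.metaOf ω), g (m (S.metaOf ω)) (S.library ω))) (a, b)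
      = prob (S.metaLaw demandLaw) m a * prob (uniformLibrary N B) (g a) b := by
  classical
  rw [prob, law_map, PMF.bind_apply, tsum_eq_single a, ENNReal.toReal_mul, prob, prob]
  · congr 2
    rw [PMF.map_apply, tsum_eq_single b]
    · simp
    · intro b' hb'
      simp [hb'.symm]
  · intro a' ha'
    rw [PMF.map_apply]
    simp [ha'.symm]

lemma prob_law_meta {μ : Type} (m : S.MetaOutcome → μ) (a : μ) :
    prob (S.law demandLaw) (fun ω => m (S.metaOf ω)) a = prob (S.metaLaw demandLaw) m a := by
  classical
  have h : S.metaLaw demandLaw = (S.law demandLaw).map S.metaOf := by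
    simp only [law, metaLaw, PMF.map_bind, PMF.pure_map, metaOf, PMF.bind_const]
    rfl
  rw [prob, prob, h, PMF.map_comp]
  rfl

variable {μ β β' : Type} [Fintype μ] [Fintype β] [Fintype β']

/-- The entropy of metadata together with a function of the library described by them. -/
lemma entropy_law_mixed (m : S.MetaOutcome → μ) (g : μ → Library N B → β) :
    entropy (S.law demandLaw) (fun ω => (m (S.metaOf ω), g (m (S.metaOf ω)) (S.library ω)))
      = entropy (S.metaLaw demandLaw) m
        + ∑ x, prob (S.metaLaw demandLaw) id x * entropy (uniformLibrary N B) (g (m x)) := by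
  rw [← sum_prob_comp_mul (S.metaLaw demandLaw) id m fun a => entropy (uniformLibrary N B) (g a)]
  have h : ∀ t : μ × β, Real.negMulLog (prob (S.law demandLaw)
      (fun ω => (m (S.metaOf ω), g (m (S.metaOf ω)) (S.library ω))) t)
      = prob (uniformLibrary N B) (g t.1) t.2 * Real.negMulLog (prob (S.metaLaw demandLaw) m t.1)
      + prob (S.metaLaw demandLaw) m t.1
        * Real.negMulLog (prob (uniformLibrary N B) (g t.1) t.2) := by
    rintro ⟨a, b⟩
    rw [prob_law_mixed, Real.negMulLog_mul]
  have h' : entropy (S.law demandLaw)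
      (fun ω => (m (S.metaOf ω), g (m (S.metaOf ω)) (S.library ω)))
      = (∑ t : μ × β, Real.negMulLog (prob (S.law demandLaw)
      (fun ω => (m (S.metaOf ω), g (m (S.metaOf ω)) (S.library ω))) t)) / Real.log 2 := rfl
  rw [h']
  simp_rw [h]
  rw [Fintype.sum_prod_type]
  simp_rw [Finset.sum_add_distrib, ← Finset.sum_mul, sum_prob, one_mul, ← Finset.mul_sum]
  rw [add_div]
  congr 1
  rw [Finset.sum_div]
  exact Finset.sum_congr rfl fun a _ => mul_div_assoc _ _ _

/-- The entropy of the metadata cancels; an average over metadata of entropies for the uniform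
library remains. -/
lemma condEntropy_law_mixed (m : S.MetaOutcome → μ) (g : μ → Library N B → β)
    (g' : μ → Library N B → β') :
    condEntropy (S.law demandLaw) (fun ω => g (m (S.metaOf ω)) (S.library ω))
        (fun ω => (m (S.metaOf ω), g' (m (S.metaOf ω)) (S.library ω)))
      = ∑ x, prob (S.metaLaw demandLaw) id x
          * condEntropy (uniformLibrary N B) (g (m x)) (g' (m x)) := by
  have h1 := S.entropy_law_mixed demandLaw m fun a F => (g a F, g' a F)
  have h2 := S.entropy_law_mixed demandLaw m g'
  have h3 : entropy (S.law demandLaw) (fun ω => (g (m (S.metaOf ω)) (S.library ω),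
      (m (S.metaOf ω), g' (m (S.metaOf ω)) (S.library ω))))
      = entropy (S.law demandLaw) (fun ω => (m (S.metaOf ω),
        (g (m (S.metaOf ω)) (S.library ω), g' (m (S.metaOf ω)) (S.library ω)))) :=
    entropy_congr _ fun ω ω' => by simp only [Prod.mk.injEq]; tauto
  rw [condEntropy, h3, h1, h2]
  simp only [condEntropy, mul_sub, Finset.sum_sub_distrib]
  ring

lemma sum_metaLaw (f : S.MetaOutcome → ℝ) :
    ∑ x, prob (S.metaLaw demandLaw) id x * f x
      = ∑ d, (demandLaw d).toReal * ∑ p, ∑ c, S.metaProb d c p * f (d, c, p) := by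
  simp only [Fintype.sum_prod_type, metaLaw_apply, Finset.mul_sum, mul_assoc]
  exact Finset.sum_congr rfl fun d _ => Finset.sum_comm

variable {S demandLaw} {M R ε : ℝ}

lemma Works.sum_card_stored_le (h : S.Works demandLaw M R ε) (k : Fin K) :
    ∑ c, (S.placement c).toReal * ((S.stored k (c k)).card : ℝ) ≤ B * (M + ε) := by
  refine le_trans ?_ (h.cache_size k)
  have h1 := S.entropy_law_mixed demandLaw (fun x => x.2.1 k) fun a => restr (S.stored k a)
  have h2 : entropy (S.law demandLaw) (S.cache k) = _ := h1
  rw [h2, sum_metaLaw]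
  refine le_trans (le_of_eq ?_) (le_add_of_nonneg_left (entropy_nonneg _ _))
  simp only [entropy_restr]
  have h3 : ∀ d, ∑ p, ∑ c, S.metaProb d c p * ((S.stored k (c k)).card : ℝ)
      = ∑ c, (S.placement c).toReal * ((S.stored k (c k)).card : ℝ) := by
    intro d
    rw [Finset.sum_comm]
    simp_rw [← Finset.sum_mul, sum_metaProb]
  simp_rw [h3, ← Finset.sum_mul, sum_toReal, one_mul]

/-- The encoding condition is a vanishing average of nonnegative terms, so it holds exactly at each
metadata value of positive probability. -/
lemma Works.condEntropy_compose_eq_zero (hD : ∀ d, demandLaw d ≠ 0)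
    (h : S.Works demandLaw M R ε) (k : Fin K) {d : Fin K → Fin N}
    {c : (k : Fin K) → S.CacheMeta k} {p : (k : Fin K) → S.PacketMeta k}
    (hp : 0 < S.metaProb d c p) :
    condEntropy (uniformLibrary N B) (S.compose k (p k)) (restr (S.stored k (c k))) = 0 := by
  have h1 := S.condEntropy_law_mixed demandLaw (fun x => (x.2.2 k, x.2.1 k))
    (fun a => S.compose k a.1) fun a => restr (S.stored k a.2)
  have h2 : condEntropy (S.law demandLaw) (S.signal k) (fun ω => (S.packetMeta k ω, S.cache k ω))
      = _ := (condEntropy_congr _ (fun ω ω' => ?_) fun ω ω' he => ?_).trans h1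
  · rw [h.encoding k] at h2
    have h3 := (Finset.sum_eq_zero_iff_of_nonneg fun x _ => mul_nonneg (prob_nonneg _ _ _)
      (condEntropy_nonneg _ _ _)).1 h2.symm (d, c, p) (Finset.mem_univ _)
    rw [metaLaw_apply] at h3
    have h4 : 0 < (demandLaw d).toReal := ENNReal.toReal_pos (hD d) (demandLaw.apply_ne_top d)
    exact (mul_eq_zero.1 h3).resolve_left (mul_pos h4 hp).ne'
  · change ((_, _), restr (S.stored k (S.cacheMeta k ω)) _)
      = ((_, _), restr (S.stored k (S.cacheMeta k ω')) _)
      ↔ (_, (_, restr (S.stored k (S.cacheMeta k ω)) _))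
      = (_, (_, restr (S.stored k (S.cacheMeta k ω')) _))
    simp only [Prod.mk.injEq, and_assoc]
    exact Iff.rfl
  · have he1 : S.packetMeta k ω = S.packetMeta k ω' := (Prod.mk.inj he).1
    change S.compose k (S.packetMeta k ω) _ = S.compose k (S.packetMeta k ω') _
      ↔ (S.packetMeta k ω, S.compose k (S.packetMeta k ω) _)
        = (S.packetMeta k ω', S.compose k (S.packetMeta k ω') _)
    simp only [Prod.mk.injEq, he1, true_and]

/-- The law of the packet metadata does not depend on the demands of the other users. -/
lemma Works.sum_metaProb_congr (hD : ∀ d, demandLaw d ≠ 0) (h : S.Works demandLaw M R ε)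
    (k : Fin K) {d d' : Fin K → Fin N} (hd : d k = d' k) (p : (k : Fin K) → S.PacketMeta k) :
    ∑ c, S.metaProb d c p = ∑ c, S.metaProb d' c p := by
  classical
  have h0 : condMutualInfo (S.law demandLaw) S.demands (fun ω => (S.metaOf ω).2.2)
      (fun ω => S.demands ω k) = 0 := by
    refine condMutualInfo_eq_zero_of_determined _ (h.privacy k) fun ω ω' he => ?_
    funext i
    exact (Prod.mk.inj (congrFun (Prod.mk.inj he).1 i)).1
  have hpos : ∀ e, 0 < (demandLaw e).toReal := fun e =>
    ENNReal.toReal_pos (hD e) (demandLaw.apply_ne_top e)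
  have h1 : ∀ e : Fin K → Fin N, prob (S.law demandLaw)
      (fun ω => (S.demands ω, (S.metaOf ω).2.2, S.demands ω k)) (e, p, e k)
      = (demandLaw e).toReal * ∑ c, S.metaProb e c p := by
    intro e
    have := S.prob_law_meta demandLaw (fun x => (x.1, x.2.2, x.1 k)) (e, p, e k)
    refine this.trans ?_
    refine (prob_comp (S.metaLaw demandLaw) id (fun x => (x.1, x.2.2, x.1 k)) (e, p, e k)).trans ?_
    have h2 : ∀ x : S.MetaOutcome, (if (x.1, x.2.2, x.1 k) = (e, p, e k) then
        prob (S.metaLaw demandLaw) id x else 0)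
        = prob (S.metaLaw demandLaw) id x * (if x.1 = e then if x.2.2 = p then 1 else 0 else 0) := by
      intro x
      by_cases hx : x.1 = e
      · by_cases hxp : x.2.2 = p <;> simp [hx, hxp]
      · simp [hx]
    simp_rw [h2, sum_metaLaw]
    simp
  have h3 : ∀ e : Fin K → Fin N, prob (S.law demandLaw)
      (fun ω => (S.demands ω, S.demands ω k)) (e, e k) = (demandLaw e).toReal := by
    intro e
    have := S.prob_law_meta demandLaw (fun x => (x.1, x.1 k)) (e, e k)
    refine this.trans ?_
    refine (prob_comp (S.metaLaw demandLaw) id (fun x => (x.1, x.1 k)) (e, e k)).trans ?_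
    have h2 : ∀ x : S.MetaOutcome, (if (x.1, x.1 k) = (e, e k) then
        prob (S.metaLaw demandLaw) id x else 0)
        = prob (S.metaLaw demandLaw) id x * (if x.1 = e then 1 else 0) := by
      intro x
      by_cases hx : x.1 = e <;> simp [hx]
    simp_rw [h2, sum_metaLaw]
    have h4 : ∑ p, ∑ c, S.metaProb e c p = 1 := by
      rw [Finset.sum_comm]
      simp_rw [sum_metaProb, sum_toReal]
    simp [h4]
  -- Conditional independence, divided by the positive probability of the demand vector `e`; the
  -- right-hand side depends on `e` only through `e k`.
  have h5 : ∀ e : Fin K → Fin N, (∑ c, S.metaProb e c p)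
      * prob (S.law demandLaw) (fun ω => S.demands ω k) (e k)
      = prob (S.law demandLaw) (fun ω => ((S.metaOf ω).2.2, S.demands ω k)) (p, e k) := by
    intro e
    have h6 := prob_mul_prob_of_condMutualInfo_eq_zero _ h0 e p (e k)
    rw [h1, h3, mul_assoc] at h6
    exact mul_left_cancel₀ (hpos e).ne' h6
  have h7 : 0 < prob (S.law demandLaw) (fun ω => S.demands ω k) (d k) :=
    ((h3 d).symm ▸ hpos d).trans_le
      (prob_le_prob_comp _ (fun ω => (S.demands ω, S.demands ω k)) Prod.snd (d, d k))
  refine mul_right_cancel₀ h7.ne' ?_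
  rw [h5 d]
  nth_rewrite 2 [hd]
  rw [h5 d', hd]

lemma Works.sum_entropy_compose_le (h : S.Works demandLaw M R ε) :
    ∑ k, ∑ x, prob (S.metaLaw demandLaw) id x
      * entropy (uniformLibrary N B) (S.compose k (x.2.2 k)) ≤ B * (R + ε) := by
  refine le_trans (Finset.sum_le_sum fun k _ => ?_) h.load
  have h1 := S.entropy_law_mixed demandLaw (fun x => x.2.2 k) fun a => S.compose k a
  have h2 : entropy (S.law demandLaw) (S.signal k) = _ := h1
  rw [h2]
  exact le_add_of_nonneg_left (entropy_nonneg _ _)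

end Scheme

/-! ### Averaging over selections, and counting bits -/

/-- If every selection of one item per index satisfies a bound, then so do averages. -/
lemma sum_weighted_le_mul {ι κ : Type} [Fintype ι] [Nonempty ι] [Fintype κ] (v φ : ι → κ → ℝ)
    (hv : ∀ i k, 0 ≤ v i k) {ρ H : ℝ} (hρ : ∀ i, ∑ k, v i k = ρ)
    (h : ∀ f : ι → κ, (∀ i, 0 < v i (f i)) → ∑ i, φ i (f i) ≤ H) :
    ∑ i, ∑ k, v i k * φ i k ≤ ρ * H := by
  classical
  by_cases hne : ∀ i, ∃ k, 0 < v i k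
  -- The bound is applied to the selection of the largest `φ i` among items of positive weight,
  -- which dominates every average.
  · have hmax : ∀ i, ∃ k, 0 < v i k ∧ ∀ k', 0 < v i k' → φ i k' ≤ φ i k := by
      intro i
      obtain ⟨k, hk, hk'⟩ := Finset.exists_max_image (Finset.univ.filter fun k => 0 < v i k) (φ i)
        (by obtain ⟨k, hk⟩ := hne i; exact ⟨k, by simpa using hk⟩)
      exact ⟨k, by simpa using hk, fun k' h' => hk' k' (by simpa using h')⟩
    choose f hf hf' using hmax
    have h1 : ∀ i, ∑ k, v i k * φ i k ≤ ρ * φ i (f i) := by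
      intro i
      rw [← hρ i, Finset.sum_mul]
      refine Finset.sum_le_sum fun k _ => ?_
      rcases (hv i k).eq_or_lt with h0 | h0
      · simp [← h0]
      · exact mul_le_mul_of_nonneg_left (hf' i k h0) h0.le
    refine (Finset.sum_le_sum fun i _ => h1 i).trans ?_
    rw [← Finset.mul_sum]
    have hρ0 : 0 ≤ ρ := hρ (Classical.arbitrary ι) ▸ Finset.sum_nonneg fun k _ => hv _ k
    exact mul_le_mul_of_nonneg_left (h f hf) hρ0
  · push Not at hne
    obtain ⟨i₀, hi₀⟩ := hne
    have hρ0 : ρ = 0 := by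
      rw [← hρ i₀]
      exact Finset.sum_eq_zero fun k _ => le_antisymm (hi₀ k) (hv i₀ k)
    have hz : ∀ i k, v i k = 0 := fun i k =>
      (Finset.sum_eq_zero_iff_of_nonneg fun k _ => hv i k).1 ((hρ i).trans hρ0) k
        (Finset.mem_univ k)
    simp [hz, hρ0]

lemma sum_card_file_inter {N B : ℕ} (s : Finset (Fin N × Fin B)) :
    ∑ n, ((file n ∩ s).card : ℝ) = s.card := by
  have h := Finset.card_eq_sum_card_fiberwise (s := s) (f := Prod.fst) (t := Finset.univ)
    fun _ _ => Finset.mem_coe.2 (Finset.mem_univ _)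
  rw [h]
  push_cast
  refine Finset.sum_congr rfl fun n _ => ?_
  congr 2
  ext b
  simp [and_comm]

lemma sum_card_file_sdiff {N B : ℕ} (s : Finset (Fin N × Fin B)) :
    ∑ n, ((file n \ s).card : ℝ) = N * B - s.card := by
  have h : ∀ n : Fin N, ((file n \ s).card : ℝ) = (B : ℝ) - (file n ∩ s).card := by
    intro n
    have h1 := Finset.card_inter_add_card_sdiff (file n) s
    have h2 : (file n : Finset (Fin N × Fin B)).card = B := by
      have : (file n : Finset (Fin N × Fin B)) = ({n} : Finset (Fin N)) ×ˢ Finset.univ := by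
        ext b; simp only [mem_file, Finset.mem_product, Finset.mem_singleton, Finset.mem_univ,
          and_true]
      rw [this]; simp
    have h3 : ((file n ∩ s).card : ℝ) + (file n \ s).card = B := by
      exact_mod_cast h1.trans h2
    linarith
  simp_rw [h]
  rw [Finset.sum_sub_distrib, sum_card_file_inter]
  simp

/-! ### The converse for a single scheme -/

namespace Scheme

variable {N B : ℕ} {S : Scheme 2 N B} {demandLaw : PMF (Fin 2 → Fin N)} {M R ε : ℝ}

/-- Given the demands, decoding fails by little on average. -/
lemma Works.sum_residual_le (hD : ∀ d, demandLaw d ≠ 0) (h : S.Works demandLaw M R ε) (k : Fin 2)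
    (d : Fin 2 → Fin N) :
    ∑ p, ∑ c, S.metaProb d c p
      * residual (fun j => S.compose j (p j)) (S.stored k (c k)) (d k)
      ≤ B * ε / (demandLaw d).toReal := by
  have hpos : 0 < (demandLaw d).toReal := ENNReal.toReal_pos (hD d) (demandLaw.apply_ne_top d)
  rw [le_div_iff₀' hpos]
  refine le_trans ?_ (h.decoding k)
  have h1 := S.condEntropy_law_mixed demandLaw (fun x => (x.2.2, x.2.1 k, x.1 k))
    (fun a F => F a.2.2)
    fun a F => ((fun j => S.compose j (a.1 j) F), restr (S.stored k a.2.1) F)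
  have h2 : condEntropy (S.law demandLaw) (S.demandedFile k)
      (fun ω => (S.signals ω, S.cache k ω, S.demands ω k)) = _ :=
    (condEntropy_congr _ (fun ω ω' => ?_) fun ω ω' _ => Iff.rfl).trans h1
  · rw [h2, sum_metaLaw]
    -- Averages over the other demand vectors are nonnegative, so a single one is controlled at the
    -- price of the factor `1 / demandLaw d`.
    refine Finset.single_le_sum (f := fun d => (demandLaw d).toReal * ∑ p, ∑ c, S.metaProb d c p
      * residual (fun j => S.compose j (p j)) (S.stored k (c k)) (d k)) (fun e _ => ?_)
      (Finset.mem_univ d)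
    exact mul_nonneg ENNReal.toReal_nonneg (Finset.sum_nonneg fun p _ => Finset.sum_nonneg
      fun c _ => mul_nonneg (S.metaProb_nonneg _ _ _) (residual_nonneg _ _ _))
  · change (((S.metaOf ω).2.2, S.cacheMeta k ω, S.demands ω k),
      ((fun j => S.compose j (S.packetMeta j ω) (S.library ω)),
        restr (S.stored k (S.cacheMeta k ω)) (S.library ω))) =
      (((S.metaOf ω').2.2, S.cacheMeta k ω', S.demands ω' k),
      ((fun j => S.compose j (S.packetMeta j ω') (S.library ω')),
        restr (S.stored k (S.cacheMeta k ω')) (S.library ω'))) ↔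
      ((fun j => (S.packetMeta j ω, S.compose j (S.packetMeta j ω) (S.library ω))),
        (S.cacheMeta k ω, restr (S.stored k (S.cacheMeta k ω)) (S.library ω)), S.demands ω k) =
      ((fun j => (S.packetMeta j ω', S.compose j (S.packetMeta j ω') (S.library ω'))),
        (S.cacheMeta k ω', restr (S.stored k (S.cacheMeta k ω')) (S.library ω')), S.demands ω' k)
    have hp : (S.metaOf ω).2.2 = (S.metaOf ω').2.2 ↔ ∀ j, S.packetMeta j ω = S.packetMeta j ω' :=
      funext_iff
    simp only [Prod.mk.injEq, hp, funext_iff, forall_and]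
    tauto

/-- The converse bound for a single scheme. -/
lemma Works.load_ge (hD : ∀ d, demandLaw d ≠ 0) (h : S.Works demandLaw M R ε) {A C : ℝ}
    (hA : 0 ≤ A) (hC : 0 ≤ C) (hN : 1 ≤ N)
    (hAC : ∀ t : ℕ, t < N → A - C * t ≤ 1 / ((t : ℝ) + 1)) :
    A * (2 * (N * B) - 2 * (B * (M + ε)))
      - C * ((N - 1) * (2 * (B * (M + ε)) - N * B
        + ∑ n : Fin N, B * ε / (demandLaw fun _ => n).toReal))
      - (1 + 3 * C * N) * (2 * ∑ n : Fin N, B * ε / (demandLaw fun _ => n).toReal)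
      ≤ B * (R + ε) := by
  classical
  set Λ := ∑ n : Fin N, B * ε / (demandLaw fun _ => n).toReal with hΛ
  set s : ((k : Fin 2) → S.CacheMeta k) → Fin 2 → Finset (Fin N × Fin B) :=
    fun c k => S.stored k (c k) with hs
  set P : ((k : Fin 2) → S.PacketMeta k) → (k : Fin 2) → Library N B → S.Packet k :=
    fun p k => S.compose k (p k) with hP
  have hN0 : Nonempty (Fin N) := ⟨⟨0, hN⟩⟩
  set d₀ : Fin 2 → Fin N := fun _ => Classical.arbitrary _
  set ρ : ((k : Fin 2) → S.PacketMeta k) → ℝ := fun p => ∑ c, S.metaProb d₀ c p with hρ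
  -- First the demand of user `1` is changed, by privacy against user `0`; then the roles are
  -- exchanged.
  have hρd : ∀ d p, ∑ c, S.metaProb d c p = ρ p := by
    intro d p
    rw [h.sum_metaProb_congr hD 0 (d' := fun i => if i = 0 then d 0 else d₀ 1) (by simp) p,
      h.sum_metaProb_congr hD 1 (d' := d₀) (by simp) p]
  have hq : ∀ d, ∀ f : ((k : Fin 2) → S.CacheMeta k) → ℝ,
      ∑ p, ∑ c, S.metaProb d c p * f c = ∑ c, (S.placement c).toReal * f c := by
    intro d f
    rw [Finset.sum_comm]
    simp_rw [← Finset.sum_mul, sum_metaProb]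
  have hload : ∑ p, ρ p * (entropy (uniformLibrary N B) (P p 0)
      + entropy (uniformLibrary N B) (P p 1)) ≤ B * (R + ε) := by
    refine le_trans (le_of_eq ?_) h.sum_entropy_compose_le
    rw [Fin.sum_univ_two, sum_metaLaw, sum_metaLaw]
    simp_rw [← Finset.sum_mul, hρd, ← Finset.sum_mul, sum_toReal, one_mul, mul_add,
      Finset.sum_add_distrib]
    rfl
  have hscore : ∀ p, ∑ l : Fin N, ∑ c, S.metaProb (fun _ => l) c p * cacheScore A C (P p) (s c) l
      ≤ ρ p * (entropy (uniformLibrary N B) (P p 0) + entropy (uniformLibrary N B) (P p 1)) := by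
    intro p
    refine sum_weighted_le_mul _ _ (fun l c => S.metaProb_nonneg _ _ _) (fun l => hρd _ p)
      fun f hf => ?_
    exact sum_cacheScore_le hC hAC (P p) (fun l => s (f l)) fun l k =>
      h.condEntropy_compose_eq_zero hD k (hf l)
  have h1 := (Finset.sum_le_sum fun p (_ : p ∈ Finset.univ) => hscore p).trans hload
  rw [Finset.sum_comm] at h1
  have hres : ∀ k : Fin 2, ∑ l : Fin N, ∑ p, ∑ c, S.metaProb (fun _ => l) c p
      * residual (P p) (s c k) l ≤ Λ := fun k =>
    Finset.sum_le_sum fun l _ => h.sum_residual_le hD k fun _ => l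
  set I : ((k : Fin 2) → S.CacheMeta k) → ℝ := fun c => ((s c 0 ∩ s c 1).card : ℝ) with hI
  have hexp : ∑ l : Fin N, ∑ p, ∑ c, S.metaProb (fun _ => l) c p * cacheScore A C (P p) (s c) l
      = ∑ c, (S.placement c).toReal
          * (A * (2 * (N * B) - (s c 0).card - (s c 1).card) - C * ((N - 1) * I c))
        - (1 + 3 * C * N) * (∑ l : Fin N, ∑ p, ∑ c, S.metaProb (fun _ => l) c p
          * residual (P p) (s c 0) l + ∑ l : Fin N, ∑ p, ∑ c, S.metaProb (fun _ => l) c p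
          * residual (P p) (s c 1) l) := by
    have e1 : ∀ l : Fin N, ∑ p, ∑ c, S.metaProb (fun _ => l) c p * cacheScore A C (P p) (s c) l
        = ∑ c, (S.placement c).toReal * (A * (((file l \ s c 0).card : ℝ) + (file l \ s c 1).card)
          - C * ∑ n ∈ Finset.univ.erase l, ((file n ∩ s c 0 ∩ s c 1).card : ℝ))
          - (1 + 3 * C * N) * (∑ p, ∑ c, S.metaProb (fun _ => l) c p * residual (P p) (s c 0) l
            + ∑ p, ∑ c, S.metaProb (fun _ => l) c p * residual (P p) (s c 1) l) := by
      intro l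
      rw [← hq (fun _ => l)]
      simp only [Finset.mul_sum, ← Finset.sum_add_distrib, ← Finset.sum_sub_distrib]
      refine Finset.sum_congr rfl fun p _ => Finset.sum_congr rfl fun c _ => ?_
      rw [cacheScore, ← Finset.mul_sum]
      ring
    simp_rw [e1]
    rw [Finset.sum_sub_distrib, ← Finset.mul_sum, Finset.sum_add_distrib, Finset.sum_comm]
    congr 1
    refine Finset.sum_congr rfl fun c _ => ?_
    rw [← Finset.mul_sum, Finset.sum_sub_distrib, ← Finset.mul_sum, ← Finset.mul_sum,
      Finset.sum_add_distrib, sum_card_file_sdiff, sum_card_file_sdiff]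
    have e2 : ∑ l : Fin N, ∑ n ∈ Finset.univ.erase l, ((file n ∩ s c 0 ∩ s c 1).card : ℝ)
        = (N - 1) * I c := by
      have e3 : ∀ l : Fin N, ∑ n ∈ Finset.univ.erase l, ((file n ∩ s c 0 ∩ s c 1).card : ℝ)
          = I c - (file l ∩ (s c 0 ∩ s c 1)).card := by
        intro l
        have e4 := sum_card_file_inter (s c 0 ∩ s c 1)
        rw [← Finset.sum_erase_add _ _ (Finset.mem_univ l)] at e4
        simp only [Finset.inter_assoc, hI]
        linarith
      simp_rw [e3]
      rw [Finset.sum_sub_distrib, sum_card_file_inter]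
      simp [hI]
      ring
    rw [e2]
    ring
  -- The left-hand side is the mean number of bits cached by neither user. These bits cannot be
  -- decoded, so the decoding errors for the demands `(n, n)` bound it, and with it the overlap from
  -- above.
  have hcov : ∑ c, (S.placement c).toReal
      * (N * B - (s c 0).card - (s c 1).card + I c) ≤ Λ := by
    have e1 : ∀ c, N * B - ((s c 0).card : ℝ) - (s c 1).card + I c
        = ∑ n, ((file n \ (s c 0 ∪ s c 1)).card : ℝ) := by
      intro c
      have e2 : ((s c 0 ∪ s c 1).card : ℝ) + I c = (s c 0).card + (s c 1).card := by
        simp only [hI]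
        exact_mod_cast Finset.card_union_add_card_inter (s c 0) (s c 1)
      rw [sum_card_file_sdiff]
      linarith
    simp_rw [e1, Finset.mul_sum]
    rw [Finset.sum_comm]
    refine le_trans (Finset.sum_le_sum fun n _ => ?_) (hres 0)
    rw [← hq (fun _ => n)]
    refine Finset.sum_le_sum fun p _ => Finset.sum_le_sum fun c _ => ?_
    rcases (S.metaProb_nonneg (fun _ => n) c p).eq_or_lt with h0 | h0
    · simp [← h0]
    · refine mul_le_mul_of_nonneg_left ?_ h0.le
      exact (card_file_sdiff_union_le n _ _ (P p 1)
        (h.condEntropy_compose_eq_zero hD 1 h0)).trans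
        (condEntropy_le_residual (P p) n (by decide) (h.condEntropy_compose_eq_zero hD 0 h0))
  have hs0 := h.sum_card_stored_le 0
  have hs1 := h.sum_card_stored_le 1
  have hq1 := sum_toReal S.placement
  rw [hexp] at h1
  set E0 := ∑ c, (S.placement c).toReal * ((s c 0).card : ℝ) with hE0
  set E1 := ∑ c, (S.placement c).toReal * ((s c 1).card : ℝ) with hE1
  set EI := ∑ c, (S.placement c).toReal * I c with hEI
  have h2 : ∑ c, (S.placement c).toReal
      * (A * (2 * (N * B) - (s c 0).card - (s c 1).card) - C * ((N - 1) * I c))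
      = A * (2 * (N * B) - E0 - E1) - C * ((N - 1) * EI) := by
    have : A * (2 * (N * B) - E0 - E1) - C * ((N - 1) * EI)
        = A * (2 * (N * B) * (∑ c, (S.placement c).toReal) - E0 - E1) - C * ((N - 1) * EI) := by
      rw [hq1, mul_one]
    rw [this, hE0, hE1, hEI]
    simp only [Finset.mul_sum, ← Finset.sum_sub_distrib]
    exact Finset.sum_congr rfl fun c _ => by ring
  have h3 : ∑ c, (S.placement c).toReal * (N * B - (s c 0).card - (s c 1).card + I c)
      = N * B - E0 - E1 + EI := by
    have : N * B - E0 - E1 + EI = N * B * (∑ c, (S.placement c).toReal) - E0 - E1 + EI := by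
      rw [hq1, mul_one]
    rw [this, hE0, hE1, hEI]
    simp only [Finset.mul_sum, ← Finset.sum_sub_distrib, ← Finset.sum_add_distrib]
    exact Finset.sum_congr rfl fun c _ => by ring
  rw [h2] at h1
  rw [h3] at hcov
  have hE0' : E0 ≤ B * (M + ε) := hs0
  have hE1' : E1 ≤ B * (M + ε) := hs1
  have hN1 : (0 : ℝ) ≤ N - 1 := by
    have : (1 : ℝ) ≤ N := by exact_mod_cast hN
    linarith
  have i1 : A * (2 * (N * B) - 2 * (B * (M + ε))) ≤ A * (2 * (N * B) - E0 - E1) :=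
    mul_le_mul_of_nonneg_left (by linarith) hA
  have i2 : C * ((N - 1) * EI) ≤ C * ((N - 1) * (2 * (B * (M + ε)) - N * B + Λ)) :=
    mul_le_mul_of_nonneg_left (mul_le_mul_of_nonneg_left (by linarith) hN1) hC
  have i3 := mul_le_mul_of_nonneg_left (add_le_add (hres 0) (hres 1))
    (show 0 ≤ 1 + 3 * C * N by positivity)
  linarith

end Scheme

/-! ### Letting the file size grow, and choosing the lines -/

lemma load_ge_of_achievable {N : ℕ} {demandLaw : PMF (Fin 2 → Fin N)}
    (hD : ∀ d, demandLaw d ≠ 0) {M R A C : ℝ} (hA : 0 ≤ A) (hC : 0 ≤ C) (hN : 1 ≤ N)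
    (hAC : ∀ t : ℕ, t < N → A - C * t ≤ 1 / ((t : ℝ) + 1)) (h : Achievable demandLaw M R) :
    A * (2 * N - 2 * M) - C * ((N - 1) * (2 * M - N)) ≤ R := by
  obtain ⟨ε, -, hε, hS⟩ := h
  set L := ∑ n : Fin N, 1 / (demandLaw fun _ => n).toReal with hL
  -- `κ` collects all coefficients of `B * ε B` in the bound for a single scheme.
  set κ := 1 + 2 * A + C * ((N - 1) * (2 + L)) + (1 + 3 * C * N) * (2 * L) with hκ
  have hlim : Tendsto (fun B => R + κ * ε B) atTop (𝓝 R) := by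
    simpa using (hε.const_mul κ).const_add R
  refine ge_of_tendsto hlim ?_
  filter_upwards [hS, eventually_gt_atTop 0] with B hB hB0
  obtain ⟨S, hW⟩ := hB
  have h1 := hW.load_ge hD hA hC hN hAC
  have h2 : ∑ n : Fin N, B * ε B / (demandLaw fun _ => n).toReal = B * ε B * L := by
    rw [hL, Finset.mul_sum]
    exact Finset.sum_congr rfl fun n _ => by ring
  rw [h2] at h1
  have hBpos : (0 : ℝ) < B := by exact_mod_cast hB0
  refine le_of_mul_le_mul_left ?_ hBpos
  rw [hκ]
  linarith

lemma le_optimalLoad {N : ℕ} {demandLaw : PMF (Fin 2 → Fin N)}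
    (hD : ∀ d, demandLaw d ≠ 0) {y A C b : ℝ} (hA : 0 ≤ A) (hC : 0 ≤ C) (hN : 1 ≤ N)
    (hAC : ∀ t : ℕ, t < N → A - C * t ≤ 1 / ((t : ℝ) + 1))
    (hb : b = A * (N - 2 * y) - C * ((N - 1) * (2 * y))) :
    (b : EReal) ≤ optimalLoad demandLaw ((N : ℝ) / 2 + y) := by
  refine le_iInf₂ fun R hR => EReal.coe_le_coe_iff.2 ?_
  have h := load_ge_of_achievable hD hA hC hN hAC hR
  rw [hb]
  linarith

end D2DCaching

theorem theorem3 (N : ℕ) (hN : 2 ≤ N) (y : ℝ) (hy : y ∈ Set.Icc (0 : ℝ) ((N : ℝ) / 2))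
    (demandLaw : PMF (Fin 2 → Fin N)) (hD : ∀ d, demandLaw d ≠ 0) :
    (∀ h : ℕ, h + 3 ≤ N →
      (((N : ℝ) - 2 * y - (4 * y + ((N : ℝ) - 1) * h) / ((h : ℝ) + 2)
        + ((h : ℝ) ^ 2 * ((N : ℝ) - 1) - (N : ℝ) * ((N : ℝ) - 3) + (h : ℝ) * ((N : ℝ) + 1))
          / (((h : ℝ) + 1) * ((h : ℝ) + 2)) * (2 * y / (N : ℝ)) : ℝ) : EReal)
        ≤ D2DCaching.optimalLoad demandLaw ((N : ℝ) / 2 + y)) ∧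
    ((2 * (1 - 3 * y / (N : ℝ)) : ℝ) : EReal)
      ≤ D2DCaching.optimalLoad demandLaw ((N : ℝ) / 2 + y) ∧
    ((2 * (1 / 2 - y / (N : ℝ)) : ℝ) : EReal)
      ≤ D2DCaching.optimalLoad demandLaw ((N : ℝ) / 2 + y) := by
  have hN1 : 1 ≤ N := by omega
  have hN2 : (2 : ℝ) ≤ N := by exact_mod_cast hN
  have hN0 : (0 : ℝ) < N := by linarith
  -- In this form `1/(t+1)` is multiplied by `N - 1 - t ≥ 0`, so it can be replaced by a smaller
  -- expression.
  have hsplit : ∀ t : ℕ, 1 / ((t : ℝ) + 1) = 1 / N * (1 + (N - 1 - t) * (1 / ((t : ℝ) + 1))) := by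
    intro t
    field_simp
    ring
  refine ⟨fun h hh => ?_, ?_, ?_⟩
  -- The line comes from the chord of `1/(t+1)` through `t = h` and `t = h + 1`, inserted in
  -- `hsplit`; the resulting quadratic in `t` is made linear by `t ≤ t * t`.
  · refine D2DCaching.le_optimalLoad hD
      (A := 1 / N * (1 + 2 * (N - 1) / (h + 2)))
      (C := 1 / N * (2 / (h + 2) + (N - 2) / ((h + 1) * (h + 2)))) ?_ ?_ hN1 ?_ ?_
    · have : (0 : ℝ) ≤ N - 1 := by linarith
      positivity
    · have : (0 : ℝ) ≤ N - 2 := by linarith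
      positivity
    · intro t ht
      have ht' : (t : ℝ) ≤ N - 1 := by
        have : (t : ℝ) + 1 ≤ N := by exact_mod_cast ht
        linarith
      rw [hsplit]
      have hsq : (t : ℝ) ≤ t * t := by exact_mod_cast Nat.le_mul_self t
      have hchord : (2 * h + 2 - t) / ((h + 1) * (h + 2)) ≤ 1 / ((t : ℝ) + 1) := by
        rw [div_le_div_iff₀ (by positivity) (by positivity)]
        -- The chord lies below the convex function at all integers, since none is strictly between
        -- `h` and `h + 1`.
        have : (0 : ℤ) ≤ ((t : ℤ) - h) * (t - h - 1) := by
          rcases le_or_gt (t : ℤ) h with h1 | h1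
          · exact mul_nonneg_of_nonpos_of_nonpos (by linarith) (by linarith)
          · exact mul_nonneg (by linarith) (by linarith)
        have h2 : (0 : ℝ) ≤ ((t : ℝ) - h) * (t - h - 1) := by exact_mod_cast this
        nlinarith
      have h3 := mul_le_mul_of_nonneg_left hchord (sub_nonneg.2 ht')
      have h4 : 1 + 2 * ((N : ℝ) - 1) / (h + 2) - (2 / (h + 2) + (N - 2) / ((h + 1) * (h + 2))) * t
          ≤ 1 + (N - 1 - t) * ((2 * h + 2 - t) / ((h + 1) * (h + 2))) := by
        rw [← sub_nonneg]
        have : 1 + (N - 1 - t) * ((2 * h + 2 - t) / ((h + 1) * (h + 2)))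
            - (1 + 2 * ((N : ℝ) - 1) / (h + 2)
              - (2 / (h + 2) + (N - 2) / ((h + 1) * (h + 2))) * t)
            = (t * t - t) / (((h : ℝ) + 1) * (h + 2)) := by
          field_simp
          ring
        rw [this]
        exact div_nonneg (by linarith) (by positivity)
      have h5 := mul_le_mul_of_nonneg_left (h4.trans (add_le_add_right h3 1))
        (show 0 ≤ 1 / (N : ℝ) by positivity)
      refine le_trans (le_of_eq ?_) h5
      ring
    · field_simp
      ring
  -- The line through the values of `1/(t+1)` at `t = N - 2` and `t = N - 1`.
  · refine D2DCaching.le_optimalLoad hD (A := 2 / N) (C := 1 / (N * (N - 1))) (by positivity)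
      ?_ hN1 ?_ ?_
    · have : (0 : ℝ) ≤ N - 1 := by linarith
      positivity
    · intro t ht
      have hN1' : (0 : ℝ) < N - 1 := by linarith
      rw [hsplit]
      have h1 : (N - 1 - t) * (1 / ((N : ℝ) - 1)) ≤ (N - 1 - t) * (1 / ((t : ℝ) + 1)) := by
        have ht' : (t : ℝ) + 1 ≤ N := by exact_mod_cast ht
        rcases Nat.lt_or_ge (t + 1) N with h2 | h2
        · have h3 : (t : ℝ) + 1 + 1 ≤ N := by exact_mod_cast h2
          refine mul_le_mul_of_nonneg_left ?_ (by linarith)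
          exact one_div_le_one_div_of_le (by positivity) (by linarith)
        · have h3 : (N : ℝ) ≤ t + 1 := by exact_mod_cast h2
          have h4 : (N : ℝ) - 1 - t = 0 := by linarith
          rw [h4, zero_mul, zero_mul]
      have h5 := mul_le_mul_of_nonneg_left (add_le_add_right h1 1)
        (show 0 ≤ 1 / (N : ℝ) by positivity)
      refine le_trans (le_of_eq ?_) h5
      field_simp
      ring
    · have hN1' : (N : ℝ) - 1 ≠ 0 := by linarith
      field_simp
      ring
  -- The horizontal line at the least value `1/N`, attained at `t = N - 1`.
  · refine D2DCaching.le_optimalLoad hD (A := 1 / N) (C := 0) (by positivity) le_rfl hN1 ?_ ?_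
    · intro t ht
      have ht' : (t : ℝ) + 1 ≤ N := by exact_mod_cast ht
      rw [zero_mul, sub_zero]
      exact one_div_le_one_div_of_le (by positivity) ht'
    · field_simp
      ring
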